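/- Let $\mathcal L$ be the set of strictly increasing sequences $u=(u(n))_{n\ge 1}$ of positive real numbers with $u(n)\to+\infty$. For a $C^1$-diffeomorphism $f$ of a closed Euclidean ball or of the interval $[0,1]$ put $$\Gamma_n(f)=\max\Bigl(\max_x\|d_xf^n\|,\ \max_x\|d_xf^{-n}\|\Bigr),\qquad n\in\mathbb N,$$ where $f^{\pm n}$ are the iterates of $f$ and of its inverse and $\|\cdot\|$ is the operator norm for the Euclidean metric. Let $B=\{x\in\mathbb R^m : |x-c|\le r\}$ be a closed Euclidean ball of dimension $m\ge 1$ (with $c\in\mathbb R^m$, $r>0$). For every $u\in\mathcal L$ there is a $C^\infty$-diffeomorphism $g\ne\mathrm{id}$ of $B$, isotopic to the identity through $C^1$-diffeomorphisms of $B$, which equals the identity near the boundary of $B$ and satisfies $$\liminf_{n\to\infty}\frac{\Gamma_n(g)}{u(n)}\le 1\qquad\text{and}\qquad \sum_{n=1}^\infty\frac1{\Gamma_n(g)}<\infty .$$ Moreover, $g$ can be chosen to be a radial extension: there is a $C^\infty$-diffeomorphism $h\neq\mathrm{id}$ of $[0,1]$, equal to the identity near $0$ and near $1$, which satisfies $\liminf_{n\to\infty}\Gamma_n(h)/u(n)\le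 1$ and $\sum_{n\ge 1}1/\Gamma_n(h)<\infty$, such that $$g(x)=c+r\,h\!\left(\frac{|x-c|}{r}\right)\frac{x-c}{|x-c|}\qquad (x\in B\setminus\{c\}).$$ -/

import Mathlib

open Set Filter Topology
open scoped ContDiff

noncomputable section

namespace GrowthSequence

/-- A self-bijection `f` of a subset `s` of a normed space `E`, as a map `E → E`. Off `s` it is
extended by the identity; all notions below only use its restriction to `s`. -/
def toMap {E : Type*} {s : Set E} (f : Equiv.Perm s) (x : E) : E :=
  open Classical in if hx : x ∈ s then (f ⟨x, hx⟩ : E) else x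

/-- `f : s → s` is a `C^n` diffeomorphism: `f` and its inverse are `C^n` on `s`, up to the boundary.
Used for closed domains `s` with unique derivatives (a closed ball, a compact interval). -/
def IsDiffeo {E : Type*} [NormedAddCommGroup E] [NormedSpace ℝ E] {s : Set E}
    (n : WithTop ℕ∞) (f : Equiv.Perm s) : Prop :=
  ContDiffOn ℝ n (toMap f) s ∧ ContDiffOn ℝ n (toMap f⁻¹) s

/-- There is a `C^1` isotopy of `s` from the identity to `f`: a family `H t`, `0 ≤ t ≤ 1`, of `C^1`
diffeomorphisms of `s`, jointly `C^1` in `(t, x)`, with `H 0 = id` and `H 1 = f`. -/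
def IsotopicToId {E : Type*} [NormedAddCommGroup E] [NormedSpace ℝ E] {s : Set E}
    (f : Equiv.Perm s) : Prop :=
  ∃ H : ℝ → Equiv.Perm s, H 0 = 1 ∧ H 1 = f ∧
    (∀ t ∈ Icc (0 : ℝ) 1, IsDiffeo 1 (H t)) ∧
    ContDiffOn ℝ 1 (fun p : ℝ × E => toMap (H p.1) p.2) (Icc (0 : ℝ) 1 ×ˢ s)

/-- `Diff₀(s)`: the `C^1` diffeomorphisms of `s` that are isotopic to the identity. -/
def DiffZero {E : Type*} [NormedAddCommGroup E] [NormedSpace ℝ E] (s : Set E) :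
    Set (Equiv.Perm s) :=
  {f | IsDiffeo 1 f ∧ IsotopicToId f}

/-- `max_{x ∈ s} ‖d_x f‖`, with the operator norm of the differential along `s`. (For a `C^1`
diffeomorphism of a closed ball or a compact interval the supremum is finite and attained.) -/
def maxDiff {E : Type*} [NormedAddCommGroup E] [NormedSpace ℝ E] {s : Set E}
    (f : Equiv.Perm s) : ℝ :=
  ⨆ x : s, ‖fderivWithin ℝ (toMap f) s (x : E)‖

/-- The growth sequence `Γ_n(f) = max (max_x ‖d_x f^n‖, max_x ‖d_x f^{-n}‖)`. -/
def growth {E : Type*} [NormedAddCommGroup E] [NormedSpace ℝ E] {s : Set E}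
    (f : Equiv.Perm s) (n : ℕ) : ℝ :=
  max (maxDiff (f ^ n)) (maxDiff (f ^ n)⁻¹)

/-- `f` equals the identity on a neighbourhood, in `s`, of the boundary of `s`. -/
def IsIdNearBoundary {E : Type*} [TopologicalSpace E] {s : Set E} (f : Equiv.Perm s) : Prop :=
  ∀ᶠ x : s in 𝓝ˢ ((↑) ⁻¹' frontier s), f x = x

/-- `liminf_n Γ_n(f) / u(n) ≤ 1` (the lower limit is taken in the extended reals) and
`∑_{n ≥ 1} 1 / Γ_n(f) < ∞`. -/
def HasIrregularGrowth {E : Type*} [NormedAddCommGroup E] [NormedSpace ℝ E] {s : Set E}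
    (u : ℕ → ℝ) (f : Equiv.Perm s) : Prop :=
  liminf (fun n : ℕ => ((growth f n / u n : ℝ) : EReal)) atTop ≤ 1 ∧
    Summable (fun n : ℕ => 1 / growth f (n + 1))

end GrowthSequence

end

noncomputable section

namespace GrowthSequence

/-! The map `h` is the unit translation of the line, carried to `(1/4, 3/4)` by a primitive `ξ` of a
positive integrable density `v` and extended by the identity. Then `h^n` has derivative `v (t + n) /
v t` at `ξ t`. Choose times `q k ≥ k` with `u (q k) ≥ exp (k + 1)`. If translating `v` by `± q k`
multiplies it by at most `exp (k + 1)`, then `Γ_n(h) ≤ u n` along `n = q k`, which gives the lower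
limit. The series converges for every such `h`: `h^{-n}` stretches the gap between the `n`-th and
`(n+1)`-th points of the orbit of `ξ 0` back to the first gap, so `1 / Γ_n` is at most a constant
times that gap, and the gaps are disjoint intervals of `(1/4, 3/4)`.

The weight of the proof is in `exists_density`. The density is a superposition of profiles `(R + (t
- a)²)^(-α)` indexed by an exponent level `n` and a word `d : ℕ →₀ ℤ` in the times `q k`. The word
places the centre at `a = ∑ d k * q k` and gives the width `R = K n * exp (wordCost d)`. Translation
by `q k` shifts words by one letter and so changes `R` by at most `exp (k + 1)`, whatever the `q k`
are. Integrability needs `α = 1/2 + excess n > 1/2`. Smoothness of `h` at `1/4` and `3/4` needs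
`v^(j) = O(v^(1 + j - δ))` for every `δ > 0`, which forces exponents arbitrarily close to `1/2`;
hence infinitely many levels. With these bounds every derivative of the displacement `ξ (t + s) - ξ
t` in the interval coordinate is `O(v^(1/2))`, so it vanishes at the ends
(`exists_flat_displacement`, `flow_smooth`).

On the ball, the radial extension keeps Lipschitz constants (`lipschitzWith_radial`) and contains
the interval orbit on a ray, so `hasIrregularGrowth_subtypePerm` covers both cases. -/

/-! ### Calculus of graded derivative bounds. -/

/-- The families of functions `f` whose derivatives of order `j ≤ N` satisfy the bound `Bd (m + j)`. -/
def SymbolUpTo {ι : Type*} (Bd : ℕ → (ι → ℝ → ℝ) → Prop) : ℕ → ℕ → (ι → ℝ → ℝ) → Prop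
  | 0, m, f => Bd m f
  | N + 1, m, f => Bd m f ∧ (∀ i, Differentiable ℝ (f i)) ∧
      SymbolUpTo Bd N (m + 1) (fun i => deriv (f i))

/-- A scale of bounds compatible with sums and products of families of functions. -/
structure IsGradedBound {ι : Type*} (Bd : ℕ → (ι → ℝ → ℝ) → Prop) : Prop where
  zero : ∀ m, Bd m (fun _ _ => 0)
  add : ∀ {m f g}, Bd m f → Bd m g → Bd m (fun i s => f i s + g i s)
  mul : ∀ {m n f g}, Bd m f → Bd n g → Bd (m + n) (fun i s => f i s * g i s)

namespace SymbolUpTo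

variable {ι : Type*} {Bd : ℕ → (ι → ℝ → ℝ) → Prop}

lemma bound {N m : ℕ} {f : ι → ℝ → ℝ} (h : SymbolUpTo Bd N m f) : Bd m f := by
  cases N with
  | zero => exact h
  | succ N => exact h.1

lemma of_succ {N m : ℕ} {f : ι → ℝ → ℝ} (h : SymbolUpTo Bd (N + 1) m f) :
    SymbolUpTo Bd N m f := by
  induction N generalizing m f with
  | zero => exact h.1
  | succ N ih => exact ⟨h.1, h.2.1, ih h.2.2⟩

lemma const (hB : IsGradedBound Bd) {m : ℕ} {c : ι → ℝ} (hc : Bd m (fun i _ => c i)) (N : ℕ) :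
    SymbolUpTo Bd N m (fun i _ => c i) := by
  induction N generalizing m c with
  | zero => exact hc
  | succ N ih =>
    refine ⟨hc, fun i => differentiable_const _, ?_⟩
    simp only [deriv_const']
    exact ih (hB.zero _)

lemma add (hB : IsGradedBound Bd) {N m : ℕ} {f g : ι → ℝ → ℝ} (hf : SymbolUpTo Bd N m f)
    (hg : SymbolUpTo Bd N m g) : SymbolUpTo Bd N m (fun i s => f i s + g i s) := by
  induction N generalizing m f g with
  | zero => exact hB.add hf hg
  | succ N ih =>
    refine ⟨hB.add hf.1 hg.1, fun i => (hf.2.1 i).add (hg.2.1 i), ?_⟩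
    have : (fun i => deriv (fun s => f i s + g i s)) =
        fun i s => deriv (f i) s + deriv (g i) s := by
      funext i s
      exact deriv_fun_add (hf.2.1 i s) (hg.2.1 i s)
    rw [this]
    exact ih hf.2.2 hg.2.2

lemma mul (hB : IsGradedBound Bd) {N m n : ℕ} {f g : ι → ℝ → ℝ} (hf : SymbolUpTo Bd N m f)
    (hg : SymbolUpTo Bd N n g) : SymbolUpTo Bd N (m + n) (fun i s => f i s * g i s) := by
  induction N generalizing m n f g with
  | zero => exact hB.mul hf hg
  | succ N ih =>
    refine ⟨hB.mul hf.1 hg.1, fun i => (hf.2.1 i).mul (hg.2.1 i), ?_⟩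
    have : (fun i => deriv (fun s => f i s * g i s)) =
        fun i s => deriv (f i) s * g i s + f i s * deriv (g i) s := by
      funext i s
      exact deriv_fun_mul (hf.2.1 i s) (hg.2.1 i s)
    rw [this]
    refine add hB ?_ ?_
    · have := ih hf.2.2 hg.of_succ
      rwa [Nat.add_right_comm] at this
    · have := ih hf.of_succ hg.2.2
      exact this

end SymbolUpTo

/-! ### The profiles and the decay of their derivatives. -/

section Profile

variable {ι : Type*} (R a α : ι → ℝ)

/-- The scale `(R + (s - a)²)^(-1/2)`. -/
def invScale (i : ι) (s : ℝ) : ℝ := (√(R i + (s - a i) ^ 2))⁻¹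

/-- The profile `(R + (s - a)²)^(-α)`. -/
def profile (i : ι) (s : ℝ) : ℝ := (R i + (s - a i) ^ 2) ^ (-α i)

/-- Families bounded by a multiple of the `m`-th power of the scale. -/
def ScaleBound (m : ℕ) (f : ι → ℝ → ℝ) : Prop :=
  ∃ C, 0 ≤ C ∧ ∀ i s, |f i s| ≤ C * invScale R a i s ^ m

lemma invScale_nonneg (i : ι) (s : ℝ) : 0 ≤ invScale R a i s := by
  unfold invScale; positivity

lemma isGradedBound_scaleBound : IsGradedBound (ScaleBound R a) where
  zero m := ⟨0, le_rfl, fun i s => by simp⟩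
  add := by
    rintro m f g ⟨C, hC, hf⟩ ⟨D, hD, hg⟩
    refine ⟨C + D, by positivity, fun i s => ?_⟩
    calc |f i s + g i s| ≤ |f i s| + |g i s| := abs_add_le _ _
      _ ≤ _ := by rw [add_mul]; exact add_le_add (hf i s) (hg i s)
  mul := by
    rintro m n f g ⟨C, hC, hf⟩ ⟨D, hD, hg⟩
    refine ⟨C * D, by positivity, fun i s => ?_⟩
    have h0 := invScale_nonneg R a i s
    calc |f i s * g i s| = |f i s| * |g i s| := abs_mul _ _
      _ ≤ (C * invScale R a i s ^ m) * (D * invScale R a i s ^ n) :=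
        mul_le_mul (hf i s) (hg i s) (abs_nonneg _) (by positivity)
      _ = _ := by rw [pow_add]; ring

variable {R a α}

lemma base_pos (hR : ∀ i, 1 ≤ R i) (i : ι) (s : ℝ) : 0 < R i + (s - a i) ^ 2 := by
  have := hR i
  positivity

lemma invScale_sq (hR : ∀ i, 1 ≤ R i) (i : ι) (s : ℝ) :
    invScale R a i s ^ 2 = (R i + (s - a i) ^ 2)⁻¹ := by
  rw [invScale, inv_pow, Real.sq_sqrt (base_pos hR i s).le]

/-- Writing `y` and `z` for the two functions, `y' = z - 2y²` and `z' = -2yz`. The pair is closed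
under differentiation with the right orders, so both claims go through one induction. -/
lemma symbol_base (hR : ∀ i, 1 ≤ R i) (N : ℕ) :
    SymbolUpTo (ScaleBound R a) N 1 (fun i s => (s - a i) * (R i + (s - a i) ^ 2)⁻¹) ∧
    SymbolUpTo (ScaleBound R a) N 2 (fun i s => (R i + (s - a i) ^ 2)⁻¹) := by
  have hB := isGradedBound_scaleBound R a
  have b1 : ScaleBound R a 1 (fun i s => (s - a i) * (R i + (s - a i) ^ 2)⁻¹) := by
    refine ⟨1, by norm_num, fun i s => ?_⟩
    have h0 := invScale_nonneg R a i s
    have hp := base_pos (a := a) hR i s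
    rw [abs_mul, ← invScale_sq hR, abs_of_nonneg (by positivity : 0 ≤ invScale R a i s ^ 2)]
    have : |s - a i| * invScale R a i s ≤ 1 := by
      rw [invScale, ← div_eq_mul_inv, div_le_one (Real.sqrt_pos.2 hp)]
      apply Real.abs_le_sqrt
      have := hR i
      linarith
    nlinarith
  have b2 : ScaleBound R a 2 (fun i s => (R i + (s - a i) ^ 2)⁻¹) := by
    refine ⟨1, by norm_num, fun i s => ?_⟩
    rw [invScale_sq hR, one_mul, abs_of_nonneg (inv_nonneg.2 (base_pos hR i s).le)]
  have d0 : ∀ i s, HasDerivAt (fun s => R i + (s - a i) ^ 2) (2 * (s - a i)) s := by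
    intro i s
    simpa using (((hasDerivAt_id s).sub_const (a i)).pow 2).const_add (R i)
  have d2 : ∀ i s, HasDerivAt (fun s => (R i + (s - a i) ^ 2)⁻¹)
      ((-2) * ((s - a i) * (R i + (s - a i) ^ 2)⁻¹) * (R i + (s - a i) ^ 2)⁻¹) s := by
    intro i s
    have hp := base_pos (a := a) hR i s
    refine ((d0 i s).fun_inv hp.ne').congr_deriv ?_
    field_simp
  have d1 : ∀ i s, HasDerivAt (fun s => (s - a i) * (R i + (s - a i) ^ 2)⁻¹)
      ((R i + (s - a i) ^ 2)⁻¹ + (-2) * ((s - a i) * (R i + (s - a i) ^ 2)⁻¹) *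
        ((s - a i) * (R i + (s - a i) ^ 2)⁻¹)) s := by
    intro i s
    refine (((hasDerivAt_id' s).sub_const (a i)).fun_mul (d2 i s)).congr_deriv ?_
    ring
  have hc : ∀ N, SymbolUpTo (ScaleBound R a) N 0 (fun _ _ => -2) := fun N =>
    SymbolUpTo.const hB (c := fun _ => -2) ⟨2, by norm_num, fun i s => by norm_num⟩ N
  induction N with
  | zero => exact ⟨b1, b2⟩
  | succ N ih =>
    refine ⟨⟨b1, fun i s => (d1 i s).differentiableAt, ?_⟩,
      ⟨b2, fun i s => (d2 i s).differentiableAt, ?_⟩⟩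
    · have : (fun i => deriv (fun s => (s - a i) * (R i + (s - a i) ^ 2)⁻¹)) =
          fun i s => (R i + (s - a i) ^ 2)⁻¹ + (-2) * ((s - a i) * (R i + (s - a i) ^ 2)⁻¹) *
            ((s - a i) * (R i + (s - a i) ^ 2)⁻¹) := by
        funext i s
        exact (d1 i s).deriv
      rw [this]
      refine SymbolUpTo.add hB ih.2 ?_
      simpa using ((hc N).mul hB ih.1).mul hB ih.1
    · have : (fun i => deriv (fun s => (R i + (s - a i) ^ 2)⁻¹)) =
          fun i s => (-2) * ((s - a i) * (R i + (s - a i) ^ 2)⁻¹) *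
            (R i + (s - a i) ^ 2)⁻¹ := by
        funext i s
        exact (d2 i s).deriv
      rw [this]
      simpa using ((hc N).mul hB ih.1).mul hB ih.2

lemma profile_pos (hR : ∀ i, 1 ≤ R i) (i : ι) (s : ℝ) : 0 < profile R a α i s :=
  Real.rpow_pos_of_pos (base_pos hR i s) _

lemma contDiff_profile (hR : ∀ i, 1 ≤ R i) (i : ι) : ContDiff ℝ ∞ (profile R a α i) := by
  unfold profile
  exact ContDiff.rpow_const_of_ne (by fun_prop) fun s => (base_pos hR i s).ne'

/-- The derivatives of the profiles decay as for a symbol, uniformly in the family. -/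
lemma iteratedDeriv_profile_bound (hR : ∀ i, 1 ≤ R i) (h0 : ∀ i, 0 ≤ α i) (h1 : ∀ i, α i ≤ 1)
    (j : ℕ) : ∃ C, 0 ≤ C ∧ ∀ i s, |iteratedDeriv j (profile R a α i) s| ≤
      C * invScale R a i s ^ j * profile R a α i s := by
  have hB := isGradedBound_scaleBound R a
  have dψ : ∀ i s, HasDerivAt (profile R a α i)
      ((-2 * α i) * ((s - a i) * (R i + (s - a i) ^ 2)⁻¹) * profile R a α i s) s := by
    intro i s
    have hp := base_pos (a := a) hR i s
    have d0 : HasDerivAt (fun s => R i + (s - a i) ^ 2) (2 * (s - a i)) s := by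
      simpa using (((hasDerivAt_id s).sub_const (a i)).pow 2).const_add (R i)
    refine (d0.rpow_const (p := -α i) (Or.inl hp.ne')).congr_deriv ?_
    simp only [profile]
    rw [Real.rpow_sub_one hp.ne']
    field_simp
  -- The logarithmic derivative of the profile is `-2α y` with `y` of order `1`, so the `j`-th
  -- derivative is the profile times some `Q` of order `j`. All `N` are carried because the next `Q`
  -- uses up one derivative of this one.
  have key : ∃ Q : ι → ℝ → ℝ, (∀ N, SymbolUpTo (ScaleBound R a) N j Q) ∧
      ∀ i s, iteratedDeriv j (profile R a α i) s = Q i s * profile R a α i s := by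
    induction j with
    | zero =>
      refine ⟨fun _ _ => 1, fun N => SymbolUpTo.const hB (c := fun _ => 1)
        ⟨1, by norm_num, fun i s => by norm_num⟩ N, fun i s => by simp⟩
    | succ j ih =>
      obtain ⟨Q, hQ, hQ'⟩ := ih
      refine ⟨fun i s => deriv (Q i) s +
        (-2 * α i) * ((s - a i) * (R i + (s - a i) ^ 2)⁻¹) * Q i s, fun N => ?_, fun i s => ?_⟩
      · refine SymbolUpTo.add hB (hQ (N + 1)).2.2 ?_
        have hc : SymbolUpTo (ScaleBound R a) N 0 (fun i _ => -2 * α i) :=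
          SymbolUpTo.const hB (c := fun i => -2 * α i) ⟨2, by norm_num, fun i s => by
            rw [abs_mul, abs_of_nonneg (h0 i)]
            norm_num
            linarith [h1 i]⟩ N
        have := (hc.mul hB (symbol_base hR N).1).mul hB (hQ N)
        simpa [add_comm] using this
      · rw [iteratedDeriv_succ, funext (hQ' i)]
        have := (((hQ 1).2.1 i) s).hasDerivAt.mul (dψ i s)
        refine (this.deriv).trans ?_
        ring
  obtain ⟨Q, hQ, hQ'⟩ := key
  obtain ⟨C, hC, h⟩ := (hQ 0).bound
  refine ⟨C, hC, fun i s => ?_⟩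
  have hp := profile_pos (a := a) (α := α) hR i s
  rw [hQ', abs_mul, abs_of_pos hp]
  exact mul_le_mul_of_nonneg_right (h i s) hp.le

end Profile

/-! ### Words in the times `q k` and their exponential summability. -/

section WordCost

/-- The weighted word norm on `ℕ →₀ ℤ` in which the `k`-th generator has weight `k + 1`. -/
def wordCost (d : ℕ →₀ ℤ) : ℝ := d.sum fun k x => ((k : ℝ) + 1) * |(x : ℝ)|

/-- The homomorphism `ℕ →₀ ℤ → ℝ` which sends the `k`-th generator to `q k`. -/
def wordValue (q : ℕ → ℕ) (d : ℕ →₀ ℤ) : ℝ := d.sum fun k x => (x : ℝ) * q k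

lemma wordCost_nonneg (d : ℕ →₀ ℤ) : 0 ≤ wordCost d :=
  Finset.sum_nonneg fun k _ => by positivity

lemma wordCost_sub_le (d e : ℕ →₀ ℤ) : wordCost (d - e) ≤ wordCost d + wordCost e := by
  classical
  have h : ∀ f : ℕ →₀ ℤ, f.support ⊆ d.support ∪ e.support →
      wordCost f = ∑ k ∈ d.support ∪ e.support, ((k : ℝ) + 1) * |(f k : ℝ)| := fun f hf =>
    Finsupp.sum_of_support_subset _ hf _ fun k _ => by simp
  rw [h _ Finsupp.support_sub, h _ Finset.subset_union_left, h _ Finset.subset_union_right,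
    ← Finset.sum_add_distrib]
  refine Finset.sum_le_sum fun k _ => ?_
  rw [← mul_add]
  refine mul_le_mul_of_nonneg_left ?_ (by positivity)
  simpa using abs_sub (d k : ℝ) (e k)

lemma wordCost_single (k : ℕ) (x : ℤ) :
    wordCost (Finsupp.single k x) = ((k : ℝ) + 1) * |(x : ℝ)| := by
  rw [wordCost, Finsupp.sum_single_index]
  simp

lemma wordValue_sub (q : ℕ → ℕ) (d e : ℕ →₀ ℤ) :
    wordValue q (d - e) = wordValue q d - wordValue q e := by
  rw [wordValue, Finsupp.sum_sub_index]
  · rfl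
  · intro k x y
    push_cast
    ring

lemma wordValue_single (q : ℕ → ℕ) (k : ℕ) (x : ℤ) :
    wordValue q (Finsupp.single k x) = x * q k := by
  rw [wordValue, Finsupp.sum_single_index]
  simp

/-- Summability of a product weight over finitely supported functions. -/
lemma summable_finsupp_prod {w : ℕ → ℤ → ℝ} {e : ℕ → ℝ} (hw : ∀ k x, 0 ≤ w k x)
    (he : Summable e) (he0 : ∀ k, 0 ≤ e k) (h0 : ∀ k, w k 0 = 1)
    (h : ∀ k (t : Finset ℤ), ∑ x ∈ t, w k x ≤ 1 + e k) :
    Summable fun d : ℕ →₀ ℤ => d.prod w := by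
  classical
  refine summable_of_sum_le (c := Real.exp (∑' k, e k))
    (fun d => Finset.prod_nonneg fun k _ => hw _ _) fun F => ?_
  set S : Finset ℕ := F.sup Finsupp.support with hS
  set t : ℕ → Finset ℤ := fun k => F.image fun d => d k with ht
  have hsub : ∀ d ∈ F, d.support ⊆ S := fun d hd => Finset.le_sup (f := Finsupp.support) hd
  have hF : F ⊆ S.finsupp t := by
    intro d hd
    rw [Finset.mem_finsupp_iff]
    exact ⟨hsub d hd, fun k _ => Finset.mem_image_of_mem (fun d : ℕ →₀ ℤ => d k) hd⟩
  -- The finite set `F` lies in a box of words supported in `S`; the sum over a box factors, and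
  -- each factor is at most `1 + e k ≤ exp (e k)`.
  calc ∑ d ∈ F, d.prod w = ∑ d ∈ F, ∏ k ∈ S, w k (d k) :=
        Finset.sum_congr rfl fun d hd =>
          Finsupp.prod_of_support_subset _ (hsub d hd) _ fun k _ => h0 k
    _ ≤ ∑ d ∈ S.finsupp t, ∏ k ∈ S, w k (d k) :=
        Finset.sum_le_sum_of_subset_of_nonneg hF fun d _ _ => Finset.prod_nonneg fun k _ => hw _ _
    _ = ∏ k ∈ S, ∑ x ∈ t k, w k x := by
        rw [Finset.prod_sum, Finset.finsupp, Finset.sum_map]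
        refine Finset.sum_congr (by congr; exact Subsingleton.elim _ _) fun p _ => ?_
        rw [← Finset.prod_attach]
        refine Finset.prod_congr rfl fun k _ => ?_
        congr 1
        exact Finsupp.indicator_of_mem k.2 p
    _ ≤ ∏ k ∈ S, Real.exp (e k) :=
        Finset.prod_le_prod (fun k _ => Finset.sum_nonneg fun x _ => hw _ _) fun k _ =>
          (h k _).trans (by linarith [Real.add_one_le_exp (e k)])
    _ = Real.exp (∑ k ∈ S, e k) := (Real.exp_sum _ _).symm
    _ ≤ _ := Real.exp_le_exp.2 (he.sum_le_tsum _ fun k _ => he0 k)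

lemma hasSum_pow_natAbs {r : ℝ} (h0 : 0 ≤ r) (h1 : r < 1) :
    HasSum (fun x : ℤ => r ^ x.natAbs) ((1 - r)⁻¹ + r * (1 - r)⁻¹) := by
  have hg := hasSum_geometric_of_lt_one h0 h1
  refine HasSum.of_nat_of_neg_add_one (f := fun x : ℤ => r ^ x.natAbs) (by simpa using hg) ?_
  have h : (fun n : ℕ => r * r ^ n) = fun n : ℕ => r ^ (-((n : ℤ) + 1)).natAbs := by
    funext n
    rw [← pow_succ']
    congr 1
  exact h ▸ hg.mul_left r

/-- The sum factors over the letters into `∑ x, r k ^ |x| = 1 + O(r k)` with `r k = exp (-ε (k +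
1))`. The weights `k + 1` in the cost make `∑ r k` converge for every `ε > 0`. -/
lemma summable_exp_wordCost {ε : ℝ} (hε : 0 < ε) :
    Summable fun d : ℕ →₀ ℤ => Real.exp (-ε * wordCost d) := by
  set r : ℕ → ℝ := fun k => Real.exp (-ε) ^ (k + 1) with hr
  have hr1 : Real.exp (-ε) < 1 := by
    rw [← Real.exp_zero]
    exact Real.exp_lt_exp.2 (by linarith)
  have hr0 : 0 < Real.exp (-ε) := Real.exp_pos _
  have hrk : ∀ k, 0 < r k := fun k => by positivity
  have hrk' : ∀ k, r k ≤ Real.exp (-ε) := fun k =>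
    (pow_le_pow_of_le_one hr0.le hr1.le (by omega : 1 ≤ k + 1)).trans (pow_one _).le
  have hsum := summable_finsupp_prod (w := fun k x => r k ^ x.natAbs)
    (e := fun k => 2 * (1 - Real.exp (-ε))⁻¹ * r k) (fun k x => by have := hrk k; positivity)
    ((((summable_geometric_of_lt_one hr0.le hr1).comp_injective
      (add_left_injective 1)).mul_left _))
    (fun k => by
      have := hrk k
      have : 0 < 1 - Real.exp (-ε) := by linarith
      positivity) (fun k => by simp) (fun k t => by
        have h1 : r k < 1 := (hrk' k).trans_lt hr1
        refine (sum_le_hasSum t (fun x _ => by have := hrk k; positivity)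
          (hasSum_pow_natAbs (hrk k).le h1)).trans ?_
        have hk : 0 < 1 - r k := by linarith
        have h2 : (1 - r k)⁻¹ ≤ (1 - Real.exp (-ε))⁻¹ :=
          inv_anti₀ (by linarith) (by linarith [hrk' k])
        have h3 : (1 - r k)⁻¹ + r k * (1 - r k)⁻¹ = 1 + 2 * (1 - r k)⁻¹ * r k := by
          field_simp
          ring
        rw [h3]
        have := hrk k
        gcongr)
  convert hsum using 2 with d
  rw [wordCost, Finsupp.sum, Finset.mul_sum, Real.exp_sum, Finsupp.prod]
  refine Finset.prod_congr rfl fun k _ => ?_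
  rw [hr, ← pow_mul, ← Real.exp_nat_mul]
  congr 1
  push_cast [Nat.cast_natAbs]
  ring

end WordCost

/-- Since `α ≤ 1` and `c ≥ 1`, `c ^ α ≤ c`; a comparison of bases thus passes to the profiles with
the same constant, independent of the exponent. -/
lemma rpow_neg_le_mul_rpow_neg {x y c α : ℝ} (hy : 0 < y) (hc : 1 ≤ c)
    (h : y ≤ c * x) (h0 : 0 ≤ α) (h1 : α ≤ 1) : x ^ (-α) ≤ c * y ^ (-α) := by
  have hc0 : 0 < c := by linarith
  calc x ^ (-α) ≤ (c⁻¹ * y) ^ (-α) := by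
        refine Real.rpow_le_rpow_of_nonpos (by positivity) ?_ (by linarith)
        rw [inv_mul_le_iff₀ hc0]
        exact h
    _ = c ^ α * y ^ (-α) := by
        rw [Real.mul_rpow (by positivity) hy.le, Real.inv_rpow hc0.le, Real.rpow_neg hc0.le, inv_inv]
    _ ≤ c * y ^ (-α) := by
        refine mul_le_mul_of_nonneg_right ?_ (by positivity)
        exact (Real.rpow_le_rpow_of_exponent_le hc h1).trans (Real.rpow_one c).le

/-! ### Masses of the profiles. -/

section ProfileIntegral
open MeasureTheory

variable {ι : Type*} {R a α : ι → ℝ}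

lemma profile_eq_scaled (hR : ∀ i, 1 ≤ R i) (i : ι) :
    profile R a α i = fun t => R i ^ (-α i) * (fun x : ℝ => (1 + ‖x‖ ^ 2) ^ (-(2 * α i) / 2))
      ((t - a i) / √(R i)) := by
  funext t
  have h : 0 < R i := by linarith [hR i]
  simp only [profile, Real.norm_eq_abs, sq_abs, div_pow, Real.sq_sqrt h.le]
  rw [show -(2 * α i) / 2 = -α i by ring, ← Real.mul_rpow h.le (by positivity)]
  congr 1
  field_simp

lemma integrable_profile (hR : ∀ i, 1 ≤ R i) (i : ι) (hα : 1 / 2 < α i) :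
    Integrable (profile R a α i) := by
  have h : 0 < R i := by linarith [hR i]
  rw [profile_eq_scaled hR]
  have := integrable_rpow_neg_one_add_norm_sq (E := ℝ) (μ := volume) (r := 2 * α i)
    (by simp; linarith)
  exact ((this.comp_div (Real.sqrt_pos.2 h).ne').comp_sub_right (a i)).const_mul _

lemma integral_profile (hR : ∀ i, 1 ≤ R i) (i : ι) :
    ∫ t, profile R a α i t =
      R i ^ (1 / 2 - α i) * ∫ x : ℝ, (1 + ‖x‖ ^ 2) ^ (-(2 * α i) / 2) := by
  have h : 0 < R i := by linarith [hR i]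
  rw [profile_eq_scaled hR, integral_const_mul,
    integral_sub_right_eq_self (fun y => (fun x : ℝ => (1 + ‖x‖ ^ 2) ^ (-(2 * α i) / 2))
      (y / √(R i))) (a i)]
  refine (congrArg (R i ^ (-α i) * ·) (Measure.integral_comp_div
    (fun x : ℝ => (1 + ‖x‖ ^ 2) ^ (-(2 * α i) / 2)) (√(R i)))).trans ?_
  rw [abs_of_nonneg (Real.sqrt_nonneg _), smul_eq_mul, ← mul_assoc, Real.sqrt_eq_rpow, ← Real.rpow_add h]
  congr 2
  ring

end ProfileIntegral

/-! ### Sums of profiles. -/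

section Superposition
open MeasureTheory

variable {ι : Type*} {R a α : ι → ℝ}

lemma invScale_le_one (hR : ∀ i, 1 ≤ R i) (i : ι) (s : ℝ) : invScale R a i s ≤ 1 := by
  refine inv_le_one_of_one_le₀ (Real.one_le_sqrt.2 ?_)
  have := hR i
  nlinarith [sq_nonneg (s - a i)]

lemma profile_le (hR : ∀ i, 1 ≤ R i) (h0 : ∀ i, 0 ≤ α i) (i : ι) (s : ℝ) :
    profile R a α i s ≤ R i ^ (-α i) := by
  have := hR i
  exact Real.rpow_le_rpow_of_nonpos (by linarith) (by nlinarith [sq_nonneg (s - a i)])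
    (by linarith [h0 i])

variable (hR : ∀ i, 1 ≤ R i) (h0 : ∀ i, 0 ≤ α i) (h1 : ∀ i, α i ≤ 1)
  (hS : Summable fun i => R i ^ (-α i))

include hR h0 hS

lemma summable_profile (t : ℝ) : Summable fun i => profile R a α i t :=
  hS.of_nonneg_of_le (fun i => (profile_pos hR i t).le) fun i => profile_le hR h0 i t

lemma profile_le_tsum (i : ι) (t : ℝ) :
    profile R a α i t ≤ ∑' i, profile R a α i t :=
  (summable_profile hR h0 hS t).le_tsum i fun j _ => (profile_pos hR j t).le

lemma tsum_profile_le (t : ℝ) : ∑' i, profile R a α i t ≤ ∑' i, R i ^ (-α i) :=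
  (summable_profile hR h0 hS t).tsum_le_tsum (fun i => profile_le hR h0 i t) hS

lemma tendsto_tsum_profile (h0' : ∀ i, 0 < α i) :
    Tendsto (fun t => ∑' i, profile R a α i t) (cocompact ℝ) (𝓝 0) := by
  have := tendsto_tsum_of_dominated_convergence (𝓕 := cocompact ℝ)
    (f := fun t i => profile R a α i t) (g := fun _ => 0) hS (fun i => ?_)
    (Eventually.of_forall fun t i => by
      rw [Real.norm_of_nonneg (profile_pos hR i t).le]
      exact profile_le hR h0 i t)
  · simpa using this
  · unfold profile
    refine (tendsto_rpow_neg_atTop (h0' i)).comp ?_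
    refine tendsto_atTop_add_const_left _ _ ?_
    have h2 : Tendsto (fun t : ℝ => ‖t - a i‖) (cocompact ℝ) atTop := by
      have h3 : Tendsto (fun t : ℝ => t - a i) (cocompact ℝ) (cocompact ℝ) :=
        (Homeomorph.subRight (a i)).isClosedEmbedding.tendsto_cocompact
      exact tendsto_norm_cocompact_atTop.comp h3
    have := (tendsto_pow_atTop (α := ℝ) two_ne_zero).comp h2
    refine this.congr fun t => ?_
    simp

include h1

omit hS in
lemma iteratedFDeriv_profile_le (j : ℕ) : ∃ C, 0 ≤ C ∧ ∀ i s,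
    ‖iteratedFDeriv ℝ j (profile R a α i) s‖ ≤ C * R i ^ (-α i) := by
  obtain ⟨C, hC, h⟩ := iteratedDeriv_profile_bound (a := a) hR h0 h1 j
  refine ⟨C, hC, fun i s => ?_⟩
  rw [norm_iteratedFDeriv_eq_norm_iteratedDeriv, Real.norm_eq_abs]
  refine (h i s).trans ?_
  refine mul_le_mul ?_ (profile_le hR h0 i s) (profile_pos hR i s).le hC
  exact mul_le_of_le_one_right hC (pow_le_one₀ (invScale_nonneg R a i s) (invScale_le_one hR i s))

lemma contDiff_tsum_profile : ContDiff ℝ ∞ fun t => ∑' i, profile R a α i t := by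
  choose C hC h using iteratedFDeriv_profile_le (a := a) hR h0 h1
  exact contDiff_tsum (contDiff_profile hR) (fun k _ => hS.mul_left (C k))
    fun k i x _ => h k i x

lemma iteratedDeriv_tsum_profile_le (j : ℕ) : ∃ C, 0 ≤ C ∧ ∀ t B,
    (∀ i, invScale R a i t ≤ B) →
    |iteratedDeriv j (fun t => ∑' i, profile R a α i t) t| ≤
      C * B ^ j * ∑' i, profile R a α i t := by
  obtain ⟨C, hC, h⟩ := iteratedDeriv_profile_bound (a := a) hR h0 h1 j
  choose D hD hD' using iteratedFDeriv_profile_le (a := a) hR h0 h1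
  refine ⟨C, hC, fun t B hB => ?_⟩
  rw [← Real.norm_eq_abs, ← norm_iteratedFDeriv_eq_norm_iteratedDeriv,
    iteratedFDeriv_tsum_apply (N := ⊤) (contDiff_profile hR) (fun k _ => hS.mul_left (D k))
      (fun k i x _ => hD' k i x) (k := j) le_top]
  refine tsum_of_norm_bounded ((summable_profile hR h0 hS t).hasSum.mul_left (C * B ^ j))
    fun i => ?_
  rw [norm_iteratedFDeriv_eq_norm_iteratedDeriv, Real.norm_eq_abs]
  refine (h i t).trans (mul_le_mul_of_nonneg_right ?_ (profile_pos hR i t).le)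
  exact mul_le_mul_of_nonneg_left (pow_le_pow_left₀ (invScale_nonneg R a i t) (hB i) j) hC

omit hS h0 h1 in
lemma integrable_tsum_profile [Countable ι] [Nonempty ι] (hα : ∀ i, 1 / 2 < α i)
    (hI : Summable fun i => ∫ t, profile R a α i t) :
    Integrable fun t => ∑' i, profile R a α i t := by
  have hi : ∀ i, Integrable (profile R a α i) := fun i => integrable_profile hR i (hα i)
  have hn : ∀ i, 0 < ∫ t, profile R a α i t := fun i => by
    rw [integral_pos_iff_support_of_nonneg (fun t => (profile_pos hR i t).le) (hi i)]
    have : Function.support (profile R a α i) = univ := by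
      ext t
      simp [(profile_pos hR i t).ne']
    simp [this]
  have hs := hasSum_integral_of_summable_integral_norm hi (by
    simpa only [Real.norm_of_nonneg (profile_pos hR _ _).le] using hI)
  -- The integral of a non-integrable function is `0` by convention, so a positive value proves
  -- integrability.
  refine Integrable.of_integral_ne_zero ?_
  rw [← hs.tsum_eq]
  obtain ⟨i⟩ := ‹Nonempty ι›
  exact (hI.tsum_pos (fun j => (hn j).le) i (hn i)).ne'

end Superposition

/-! ### The density with prescribed almost-periods. -/

section Density
open MeasureTheory

/-- The excess of the `n`-th decay exponent over `1 / 2`. -/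
def excess (n : ℕ) : ℝ := 1 / (2 * ((n : ℝ) + 1))

lemma excess_pos (n : ℕ) : 0 < excess n := by unfold excess; positivity

lemma excess_le (n : ℕ) : excess n ≤ 1 / 2 := by
  unfold excess
  apply one_div_le_one_div_of_le <;> norm_num

lemma tendsto_excess : Tendsto excess atTop (𝓝 0) := by
  have := (tendsto_one_div_add_atTop_nhds_zero_nat (𝕜 := ℝ)).const_mul (1 / 2)
  rw [mul_zero] at this
  refine this.congr fun n => ?_
  unfold excess
  field_simp

/-- The mass of the profile of unit width with the `n`-th decay exponent. -/
def unitMass (n : ℕ) : ℝ := ∫ x : ℝ, (1 + ‖x‖ ^ 2) ^ (-(2 * (1 / 2 + excess n)) / 2)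

lemma unitMass_nonneg (n : ℕ) : 0 ≤ unitMass n :=
  integral_nonneg fun x => by positivity

/-- The sum over words blows up in an uncontrolled way as the excess shrinks; a large base width `K`
for each level compensates. -/
lemma exists_width (n : ℕ) : ∃ K : ℝ, 1 ≤ K ∧
    K ^ (-excess n) * ((1 + unitMass n) * ∑' d, Real.exp (-excess n * wordCost d)) ≤
      (1 / 2) ^ n := by
  have h := (tendsto_rpow_neg_atTop (excess_pos n)).mul_const
    ((1 + unitMass n) * ∑' d, Real.exp (-excess n * wordCost d))
  rw [zero_mul] at h
  have h2 := h.eventually (eventually_le_nhds (show (0 : ℝ) < (1 / 2) ^ n by positivity))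
  obtain ⟨K, hK, hK'⟩ := (h2.and (eventually_ge_atTop 1)).exists
  exact ⟨K, hK', hK⟩

/-- A smooth integrable density on the line, all of whose translates by `± q k` are comparable to
it with the constant `exp (k + 1)`, and whose derivatives decay almost as fast as
its powers. -/
theorem exists_density (q : ℕ → ℕ) : ∃ v : ℝ → ℝ, (∀ t, 0 < v t) ∧ ContDiff ℝ ∞ v ∧
    Integrable v ∧ Tendsto v (cocompact ℝ) (𝓝 0) ∧
    (∀ (j : ℕ) (δ : ℝ), 0 < δ → ∃ C, ∀ t, |iteratedDeriv j v t| ≤ C * v t ^ (1 + j - δ)) ∧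
    (∀ s t, v (t + s) ≤ (2 + 2 * s ^ 2) * v t) ∧
    (∀ k t, v (t + q k) ≤ Real.exp (k + 1) * v t ∧ v (t - q k) ≤ Real.exp (k + 1) * v t) := by
  choose K hK1 hK using exists_width
  set R : ℕ × (ℕ →₀ ℤ) → ℝ := fun i => K i.1 * Real.exp (wordCost i.2) with hRdef
  set a : ℕ × (ℕ →₀ ℤ) → ℝ := fun i => wordValue q i.2 with ha
  set α : ℕ × (ℕ →₀ ℤ) → ℝ := fun i => 1 / 2 + excess i.1 with hα
  have hK0 : ∀ n, 0 < K n := fun n => by linarith [hK1 n]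
  have hR : ∀ i, 1 ≤ R i := fun i =>
    one_le_mul_of_one_le_of_one_le (hK1 _) (Real.one_le_exp (wordCost_nonneg _))
  have h0' : ∀ i, 1 / 2 < α i := fun i => by simp only [hα]; linarith [excess_pos i.1]
  have h0p : ∀ i, 0 < α i := fun i => by linarith [h0' i]
  have h0 : ∀ i, 0 ≤ α i := fun i => (h0p i).le
  have h1 : ∀ i, α i ≤ 1 := fun i => by simp only [hα]; linarith [excess_le i.1]
  -- This one series dominates both the suprema `R ^ (-α)` and the masses `R ^ (1/2 - α) *
  -- unitMass`.
  have hT : Summable fun i : ℕ × (ℕ →₀ ℤ) => R i ^ (-excess i.1) * (1 + unitMass i.1) := by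
    have e : ∀ n d, R (n, d) ^ (-excess n) * (1 + unitMass n) =
        (K n ^ (-excess n) * (1 + unitMass n)) * Real.exp (-excess n * wordCost d) := by
      intro n d
      simp only [hRdef]
      rw [Real.mul_rpow (hK0 n).le (Real.exp_pos _).le, ← Real.exp_mul, mul_comm (wordCost d)]
      ring
    rw [summable_prod_of_nonneg fun i => ?_]
    · refine ⟨fun n => ?_, ?_⟩
      · simp only [e]
        exact (summable_exp_wordCost (excess_pos n)).mul_left _
      · refine summable_geometric_two.of_nonneg_of_le (fun n => tsum_nonneg fun d => ?_)
          fun n => ?_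
        · have := unitMass_nonneg n
          have := hR (n, d)
          positivity
        · simp only [e]
          rw [tsum_mul_left, mul_assoc]
          exact hK n
    · have := unitMass_nonneg i.1
      have := hR i
      simp only [Pi.zero_apply]
      positivity
  have hS : Summable fun i => R i ^ (-α i) := by
    refine hT.of_nonneg_of_le (fun i => by have := hR i; positivity) fun i => ?_
    have hb := hR i
    have hm := unitMass_nonneg i.1
    calc R i ^ (-α i) ≤ R i ^ (-excess i.1) :=
          Real.rpow_le_rpow_of_exponent_le hb (by simp only [hα]; linarith)
      _ ≤ _ := le_mul_of_one_le_right (by positivity) (by linarith)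
  have hI : Summable fun i => ∫ t, profile R a α i t := by
    refine hT.of_nonneg_of_le (fun i => integral_nonneg fun t => (profile_pos hR i t).le)
      fun i => ?_
    have hb := hR i
    have hm := unitMass_nonneg i.1
    rw [integral_profile hR]
    simp only [hα]
    rw [show (1 / 2 - (1 / 2 + excess i.1)) = -excess i.1 by ring]
    refine mul_le_mul_of_nonneg_left ?_ (by positivity)
    change unitMass i.1 ≤ _
    linarith
  have hsum := fun t => summable_profile (a := a) hR h0 hS t
  set v : ℝ → ℝ := fun t => ∑' i, profile R a α i t with hv
  have hvpos : ∀ t, 0 < v t := fun t =>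
    (profile_pos hR (0, 0) t).trans_le (profile_le_tsum hR h0 hS (0, 0) t)
  obtain ⟨B, hB⟩ : ∃ B, B = 1 + ∑' i, R i ^ (-α i) := ⟨_, rfl⟩
  have hvB : ∀ t, v t ≤ B := fun t => by linarith [tsum_profile_le (a := a) hR h0 hS t]
  have hB1 : 1 ≤ B := by
    have : 0 ≤ ∑' i, R i ^ (-α i) := tsum_nonneg fun i => by have := hR i; positivity
    linarith
  have hbig : ∀ x y t : ℝ, y ≤ x → v t ^ x ≤ B ^ (x - y) * v t ^ y := by
    intro x y t hxy
    have : v t ^ x = v t ^ (x - y) * v t ^ y := by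
      rw [← Real.rpow_add (hvpos t)]
      ring_nf
    rw [this]
    refine mul_le_mul_of_nonneg_right ?_ (Real.rpow_nonneg (hvpos t).le _)
    exact Real.rpow_le_rpow (hvpos t).le (hvB t) (by linarith)
  have hexp : ∀ {x y : ℝ} (t : ℝ), y ≤ x → x - y ≤ 1 → v t ^ x ≤ B * v t ^ y := by
    intro x y t hxy hxy1
    refine (hbig x y t hxy).trans
      (mul_le_mul_of_nonneg_right ?_ (Real.rpow_nonneg (hvpos t).le _))
    exact (Real.rpow_le_rpow_of_exponent_le hB1 hxy1).trans (Real.rpow_one B).le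
  -- A profile is its inverse scale to the power `2α = 1 + 2 * excess`, and is at most `v`. This
  -- settles levels of small excess. An index of another level is compared with the same word at
  -- level `n₀`: same centre, and `R` larger by at most the factor `K n₀`.
  have hscale : ∀ δ : ℝ, 0 < δ → δ ≤ 1 → ∃ C, 0 ≤ C ∧ ∀ i t, invScale R a i t ≤ C * v t ^ (1 - δ) := by
    intro δ hδ hδ1
    obtain ⟨n₀, hn₀⟩ := (tendsto_excess.eventually
      (eventually_le_nhds (show (0 : ℝ) < δ / 2 by linarith))).exists
    have own : ∀ i t, excess i.1 ≤ δ / 2 → invScale R a i t ≤ B * v t ^ (1 - δ) := by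
      intro i t hi
      have hp := base_pos (a := a) hR i t
      have he := excess_pos i.1
      have e1 : invScale R a i t = profile R a α i t ^ (1 / (1 + 2 * excess i.1)) := by
        rw [invScale, profile, ← Real.rpow_mul hp.le, Real.sqrt_eq_rpow, ← Real.rpow_neg hp.le]
        congr 1
        simp only [hα]
        field_simp
      rw [e1]
      refine (Real.rpow_le_rpow (profile_pos hR i t).le (profile_le_tsum hR h0 hS i t)
        (by positivity)).trans (hexp t ?_ ?_)
      · rw [le_div_iff₀ (by positivity)]
        nlinarith
      · have : 1 / (1 + 2 * excess i.1) ≤ 1 := by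
          rw [div_le_one (by positivity)]
          linarith
        linarith
    refine ⟨√(K n₀) * B, by positivity, fun i t => ?_⟩
    have hv0 := Real.rpow_nonneg (hvpos t).le (1 - δ)
    have hK1' : 1 ≤ √(K n₀) := Real.one_le_sqrt.2 (hK1 n₀)
    rw [mul_assoc]
    by_cases hi : excess i.1 ≤ δ / 2
    · refine (own i t hi).trans (le_mul_of_one_le_left (by positivity) hK1')
    · refine le_trans ?_ (mul_le_mul_of_nonneg_left (own (n₀, i.2) t hn₀) (by positivity))
      have hp := base_pos (a := a) hR i t
      have hp' := base_pos (a := a) hR (n₀, i.2) t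
      have ha' : a (n₀, i.2) = a i := rfl
      have hRR : R (n₀, i.2) ≤ K n₀ * R i := by
        simp only [hRdef]
        refine mul_le_mul_of_nonneg_left ?_ (hK0 _).le
        exact le_mul_of_one_le_left (Real.exp_pos _).le (hK1 _)
      rw [invScale, invScale, ← div_eq_mul_inv, inv_eq_one_div,
        div_le_div_iff₀ (Real.sqrt_pos.2 hp) (Real.sqrt_pos.2 hp'), one_mul,
        ← Real.sqrt_mul (hK0 _).le]
      refine Real.sqrt_le_sqrt ?_
      rw [ha']
      nlinarith [hK1 n₀, sq_nonneg (t - a i)]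
  refine ⟨v, hvpos, contDiff_tsum_profile hR h0 h1 hS, integrable_tsum_profile hR h0' hI,
    tendsto_tsum_profile hR h0 hS h0p, ?_, ?_, ?_⟩
  · intro j δ hδ
    obtain ⟨C, hC, h⟩ := iteratedDeriv_tsum_profile_le (a := a) hR h0 h1 hS j
    -- Each of the `j` factors of the inverse scale loses `δ'` in the exponent; the total loss must
    -- not exceed `δ`.
    obtain ⟨δ', hδ', hδ'1, hδ'2, hδ'3⟩ : ∃ δ' : ℝ, 0 < δ' ∧ δ' ≤ 1 ∧ j * δ' ≤ δ ∧
        δ' ≤ δ := by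
      refine ⟨min 1 (δ / (j + 1)), lt_min one_pos (by positivity), min_le_left _ _, ?_, ?_⟩
      · have : min 1 (δ / (j + 1)) ≤ δ / (j + 1) := min_le_right _ _
        rw [le_div_iff₀ (by positivity)] at this
        have : (0 : ℝ) < min 1 (δ / (j + 1)) := lt_min one_pos (by positivity)
        nlinarith
      · refine (min_le_right _ _).trans (div_le_self hδ.le ?_)
        linarith [(Nat.cast_nonneg j : (0 : ℝ) ≤ j)]
    obtain ⟨D, hD, hD'⟩ := hscale δ' hδ' hδ'1
    have key : ∀ t, |iteratedDeriv j v t| ≤ C * D ^ j * v t ^ (1 + j * (1 - δ')) := by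
      intro t
      refine (h t _ fun i => hD' i t).trans (le_of_eq ?_)
      rw [mul_pow, Real.rpow_add (hvpos t), Real.rpow_one, mul_comm (j : ℝ), Real.rpow_mul_natCast
        (hvpos t).le]
      ring
    refine ⟨C * D ^ j * B ^ (1 + j * (1 - δ') - (1 + j - δ)), fun t => (key t).trans ?_⟩
    rw [mul_assoc (C * D ^ j)]
    exact mul_le_mul_of_nonneg_left (hbig _ _ t (by nlinarith)) (by positivity)
  · intro s t
    simp only [hv]
    rw [← tsum_mul_left]
    refine (hsum _).tsum_le_tsum (fun i => ?_) ((hsum t).mul_left _)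
    -- The bases compare because `(t - a)² ≤ 2 (t + s - a)² + 2 s²` and `R ≥ 1`.
    refine rpow_neg_le_mul_rpow_neg (base_pos hR i t) (by nlinarith [sq_nonneg s])
      ?_ (h0 i) (h1 i)
    have := hR i
    nlinarith [sq_nonneg (t - a i + 2 * s), sq_nonneg s, sq_nonneg (t + s - a i),
      mul_nonneg (sq_nonneg s) (sq_nonneg (t + s - a i)),
      mul_nonneg (sq_nonneg s) (by linarith : (0 : ℝ) ≤ R i - 1)]
  -- Reindex `v t` by `d ↦ d - e`: the term of `d` on the left and that of `d - e` on the right have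
  -- the same distance to their centres, and subadditivity of the cost compares the widths.
  · have shift : ∀ (e : ℕ →₀ ℤ) t, v (t + wordValue q e) ≤ Real.exp (wordCost e) * v t := by
      intro e t
      have hre : v t = ∑' i : ℕ × (ℕ →₀ ℤ), profile R a α (i.1, i.2 - e) t :=
        ((Equiv.prodCongr (Equiv.refl ℕ) (Equiv.subRight e)).tsum_eq
          fun i => profile R a α i t).symm
      have hsm : Summable fun i : ℕ × (ℕ →₀ ℤ) => profile R a α (i.1, i.2 - e) t :=
        (Equiv.prodCongr (Equiv.refl ℕ) (Equiv.subRight e)).summable_iff.2 (hsum t)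
      rw [hre, ← tsum_mul_left]
      refine (hsum _).tsum_le_tsum (fun i => ?_) (hsm.mul_left _)
      have hc1 := Real.one_le_exp (wordCost_nonneg e)
      refine rpow_neg_le_mul_rpow_neg (base_pos hR (i.1, i.2 - e) t) hc1
        ?_ (h0 i) (h1 i)
      have hRR : R (i.1, i.2 - e) ≤ Real.exp (wordCost e) * R i := by
        simp only [hRdef]
        rw [mul_left_comm, ← Real.exp_add]
        refine mul_le_mul_of_nonneg_left (Real.exp_le_exp.2 ?_) (hK0 _).le
        linarith [wordCost_sub_le i.2 e]
      have haa : t - a (i.1, i.2 - e) = t + wordValue q e - a i := by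
        simp only [ha, wordValue_sub]
        ring
      rw [haa]
      nlinarith [sq_nonneg (t + wordValue q e - a i)]
    intro k t
    constructor
    · simpa [wordValue_single, wordCost_single] using shift (Finsupp.single k 1) t
    · have := shift (Finsupp.single k (-1)) t
      rw [wordValue_single, wordCost_single] at this
      simpa [sub_eq_add_neg] using this

end Density

/-! ### The chart from the line to the interval. -/

/-- `ξ` identifies the line with `(1/4, 3/4)`, with a density `v` whose derivatives decay fast enough
to make the translations of the line smooth flat maps of the interval. -/
structure IsFlowChart (v ξ : ℝ → ℝ) : Prop where
  pos : ∀ t, 0 < v t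
  contDiff : ContDiff ℝ ∞ v
  hasDerivAt : ∀ t, HasDerivAt ξ (v t) t
  tendsto_zero : Tendsto v (cocompact ℝ) (𝓝 0)
  bound : ∀ (j : ℕ) (δ : ℝ), 0 < δ → ∃ C, ∀ t, |iteratedDeriv j v t| ≤ C * v t ^ (1 + j - δ)
  shift : ∀ s t, v (t + s) ≤ (2 + 2 * s ^ 2) * v t
  atBot : Tendsto ξ atBot (𝓝 (1 / 4))
  atTop : Tendsto ξ atTop (𝓝 (3 / 4))

open MeasureTheory in
theorem exists_flowChart (q : ℕ → ℕ) : ∃ v ξ : ℝ → ℝ, IsFlowChart v ξ ∧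
    ∀ k t, v (t + q k) ≤ Real.exp (k + 1) * v t ∧ v (t - q k) ≤ Real.exp (k + 1) * v t := by
  obtain ⟨w, hpos, hsm, hint, h0, hb, hs, hq⟩ := exists_density q
  have hcont := hsm.continuous
  set T := ∫ t, w t with hT
  have hTpos : 0 < T := by
    rw [hT, integral_pos_iff_support_of_nonneg (fun t => (hpos t).le) hint]
    have : Function.support w = univ := by
      ext t
      simp [(hpos t).ne']
    simp [this]
  -- The scaling gives total mass `1/2`, the length of `(1/4, 3/4)`.
  set c : ℝ := 1 / (2 * T) with hc
  have hc0 : 0 < c := by positivity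
  set A := ∫ t in Iic (0 : ℝ), w t with hA
  set B := ∫ t in Ioi (0 : ℝ), w t with hB
  have hAB : A + B = T := by
    have := integral_add_compl (measurableSet_Iic (a := (0 : ℝ))) hint
    rwa [compl_Iic] at this
  have hcT : c * T = 1 / 2 := by rw [hc]; field_simp
  refine ⟨fun t => c * w t, fun t => 1 / 4 + c * (A + ∫ x in (0 : ℝ)..t, w x),
    ⟨fun t => mul_pos hc0 (hpos t), contDiff_const.mul hsm, fun t => ?_, ?_, fun j δ hδ => ?_,
      fun s t => ?_, ?_, ?_⟩, fun k t => ⟨?_, ?_⟩⟩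
  · exact ((((intervalIntegral.integral_hasDerivAt_right (hcont.intervalIntegrable _ _)
      (hcont.stronglyMeasurableAtFilter _ _) hcont.continuousAt).const_add A).const_mul
        c).const_add (1 / 4))
  · simpa using h0.const_mul c
  · obtain ⟨C, hC⟩ := hb j δ hδ
    refine ⟨c * C * (c ^ (1 + j - δ))⁻¹, fun t => ?_⟩
    have hcp : 0 < c ^ (1 + j - δ) := Real.rpow_pos_of_pos hc0 _
    rw [iteratedDeriv_const_mul_field, abs_mul, abs_of_pos hc0, Real.mul_rpow hc0.le (hpos t).le]
    calc c * |iteratedDeriv j w t| ≤ c * (C * w t ^ (1 + j - δ)) :=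
          mul_le_mul_of_nonneg_left (hC t) hc0.le
      _ = _ := by field_simp
  · have := mul_le_mul_of_nonneg_left (hs s t) hc0.le
    linarith
  · have h1 : Tendsto (fun t => ∫ x in t..(0 : ℝ), w x) Filter.atBot (𝓝 A) :=
      intervalIntegral_tendsto_integral_Iic 0 hint.integrableOn tendsto_id
    have h2 := ((h1.const_sub A).const_mul c).const_add (1 / 4)
    simp only [sub_self, mul_zero, add_zero] at h2
    refine h2.congr fun t => ?_
    rw [intervalIntegral.integral_symm 0 t]
    ring
  · have h1 : Tendsto (fun t => ∫ x in (0 : ℝ)..t, w x) Filter.atTop (𝓝 B) :=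
      intervalIntegral_tendsto_integral_Ioi 0 hint.integrableOn tendsto_id
    have h2 := ((h1.const_add A).const_mul c).const_add (1 / 4)
    rw [hAB, hcT] at h2
    convert h2 using 2
    norm_num
  · have := mul_le_mul_of_nonneg_left (hq k t).1 hc0.le
    linarith
  · have := mul_le_mul_of_nonneg_left (hq k t).2 hc0.le
    linarith

/-! ### Flatness at the end points. -/

/-- A function vanishing off an interval is smooth if it is smooth inside and all its derivatives
tend to zero at the end points. -/
lemma contDiff_of_flat {F : ℕ → ℝ → ℝ} {a b : ℝ} (hab : a < b)
    (hz : ∀ p x, x ∉ Ioo a b → F p x = 0)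
    (hd : ∀ p, ∀ x ∈ Ioo a b, HasDerivAt (F p) (F (p + 1) x) x)
    (ha : ∀ p, Tendsto (F p) (𝓝[>] a) (𝓝 0)) (hb : ∀ p, Tendsto (F p) (𝓝[<] b) (𝓝 0)) :
    (∀ p x, HasDerivAt (F p) (F (p + 1) x) x) ∧ ContDiff ℝ ∞ (F 0) := by
  have hder : ∀ p x, HasDerivAt (F p) (F (p + 1) x) x := by
    intro p x
    have hdiff : DifferentiableOn ℝ (F p) (Ioo a b) := fun y hy =>
      (hd p y hy).differentiableAt.differentiableWithinAt
    have hza : ∀ p, F p a = 0 := fun p => hz p a (by simp)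
    have hzb : ∀ p, F p b = 0 := fun p => hz p b (by simp)
    have hma : Ioo a b ∈ 𝓝[>] a := Ioo_mem_nhdsGT hab
    have hmb : Ioo a b ∈ 𝓝[<] b := Ioo_mem_nhdsLT hab
    rcases lt_trichotomy x a with h | h | h
    · rw [hz _ x (fun hx => absurd hx.1 h.not_gt)]
      refine (hasDerivAt_const x (0 : ℝ)).congr_of_eventuallyEq ?_
      filter_upwards [Iio_mem_nhds h] with y hy
      exact hz _ y fun hy' => absurd hy'.1 (not_lt.2 (le_of_lt hy))
    · subst h
      rw [hza]
      have h1 : HasDerivWithinAt (F p) 0 (Ici x) x := by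
        refine hasDerivWithinAt_Ici_of_tendsto_deriv hdiff ?_ hma ?_
        · rw [ContinuousWithinAt, hza]
          exact (ha p).mono_left (nhdsWithin_mono _ fun y hy => hy.1)
        · refine (ha (p + 1)).congr' ?_
          filter_upwards [hma] with y hy
          exact (hd p y hy).deriv.symm
      have h2 : HasDerivWithinAt (F p) 0 (Iic x) x :=
        (hasDerivWithinAt_const x _ (0 : ℝ)).congr
          (fun y hy => hz _ y fun hy' => absurd hy'.1 (not_lt.2 hy)) (hza p)
      have := h2.union h1
      rwa [Iic_union_Ici, hasDerivWithinAt_univ] at this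
    rcases lt_trichotomy x b with h' | h' | h'
    · exact hd p x ⟨h, h'⟩
    · subst h'
      rw [hzb]
      have h1 : HasDerivWithinAt (F p) 0 (Iic x) x := by
        refine hasDerivWithinAt_Iic_of_tendsto_deriv hdiff ?_ hmb ?_
        · rw [ContinuousWithinAt, hzb]
          exact (hb p).mono_left (nhdsWithin_mono _ fun y hy => hy.2)
        · refine (hb (p + 1)).congr' ?_
          filter_upwards [hmb] with y hy
          exact (hd p y hy).deriv.symm
      have h2 : HasDerivWithinAt (F p) 0 (Ici x) x :=
        (hasDerivWithinAt_const x _ (0 : ℝ)).congr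
          (fun y hy => hz _ y fun hy' => absurd hy'.2 (not_lt.2 hy)) (hzb p)
      have := h1.union h2
      rwa [Iic_union_Ici, hasDerivWithinAt_univ] at this
    · rw [hz _ x (fun hx => absurd hx.2 h'.not_gt)]
      refine (hasDerivAt_const x (0 : ℝ)).congr_of_eventuallyEq ?_
      filter_upwards [Ioi_mem_nhds h'] with y hy
      exact hz _ y fun hy' => absurd hy'.2 (not_lt.2 (le_of_lt hy))
  refine ⟨hder, contDiff_of_differentiable_iteratedDeriv fun m _ => ?_⟩
  have : iteratedDeriv m (F 0) = F m := by
    induction m with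
    | zero => simp
    | succ m ih =>
      rw [iteratedDeriv_succ, ih (by exact_mod_cast le_top)]
      funext x
      exact (hder m x).deriv
  rw [this]
  exact fun x => (hder m x).differentiableAt

namespace IsFlowChart

variable {v ξ : ℝ → ℝ}

/-- Bounds by powers of the density, up to an arbitrarily small loss in the exponent. -/
def PowerBound (v : ℝ → ℝ) (m : ℕ) (f : Unit → ℝ → ℝ) : Prop :=
  ∀ δ : ℝ, 0 < δ → δ ≤ 1 → ∃ C, 0 ≤ C ∧ ∀ i t, |f i t| ≤ C * v t ^ ((m : ℝ) - δ)

lemma isGradedBound_powerBound (hv : ∀ t, 0 < v t) : IsGradedBound (PowerBound v) where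
  zero m δ _ _ := ⟨0, le_rfl, fun i s => by simp⟩
  add := by
    intro m f g hf hg δ hδ hδ1
    obtain ⟨C, hC, hf⟩ := hf δ hδ hδ1
    obtain ⟨D, hD, hg⟩ := hg δ hδ hδ1
    refine ⟨C + D, by positivity, fun i s => ?_⟩
    calc |f i s + g i s| ≤ |f i s| + |g i s| := abs_add_le _ _
      _ ≤ _ := by rw [add_mul]; exact add_le_add (hf i s) (hg i s)
  mul := by
    intro m n f g hf hg δ hδ hδ1
    obtain ⟨C, hC, hf⟩ := hf (δ / 2) (by linarith) (by linarith)
    obtain ⟨D, hD, hg⟩ := hg (δ / 2) (by linarith) (by linarith)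
    refine ⟨C * D, by positivity, fun i s => ?_⟩
    have h0 := hv s
    calc |f i s * g i s| = |f i s| * |g i s| := abs_mul _ _
      _ ≤ (C * v s ^ ((m : ℝ) - δ / 2)) * (D * v s ^ ((n : ℝ) - δ / 2)) :=
        mul_le_mul (hf i s) (hg i s) (abs_nonneg _) (by positivity)
      _ = C * D * (v s ^ ((m : ℝ) - δ / 2) * v s ^ ((n : ℝ) - δ / 2)) := by ring
      _ = _ := by
        rw [← Real.rpow_add h0]
        congr 2
        push_cast
        ring

lemma symbol_of_iteratedDeriv {m : ℕ} {f : ℝ → ℝ} (hf : ContDiff ℝ ∞ f)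
    (h : ∀ j, PowerBound v (m + j) fun _ => iteratedDeriv j f) (N : ℕ) :
    SymbolUpTo (PowerBound v) N m fun _ => f := by
  induction N generalizing m f with
  | zero =>
    change PowerBound v m _
    simpa using h 0
  | succ N ih =>
    refine ⟨by simpa using h 0, fun _ => hf.differentiable (by simp), ?_⟩
    refine ih (contDiff_infty_iff_deriv.1 hf).2 fun j => ?_
    have := h (j + 1)
    rw [iteratedDeriv_succ'] at this
    rwa [add_assoc, add_comm 1 j]

variable (h : IsFlowChart v ξ)
include h

lemma powerBound_iteratedDeriv (j : ℕ) : PowerBound v (1 + j) fun _ => iteratedDeriv j v := by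
  intro δ hδ _
  obtain ⟨C, hC⟩ := h.bound j δ hδ
  refine ⟨C, ?_, fun _ t => by push_cast; exact hC t⟩
  have h1 := (abs_nonneg _).trans (hC 0)
  exact nonneg_of_mul_nonneg_left h1 (Real.rpow_pos_of_pos (h.pos 0) _)

lemma deriv_eq : deriv ξ = v := funext fun t => (h.hasDerivAt t).deriv

lemma contDiff_chart : ContDiff ℝ ∞ ξ := by
  rw [contDiff_infty_iff_deriv, h.deriv_eq]
  exact ⟨fun t => (h.hasDerivAt t).differentiableAt, h.contDiff⟩

/-- By the mean value inequality the difference is controlled by a derivative of `v` between `t` and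
`t + s`, where `v` is at most `(2 + 2s²) v t`. -/
lemma powerBound_difference (s : ℝ) (j : ℕ) :
    PowerBound v (1 + j) fun _ t => iteratedDeriv j ξ (t + s) - iteratedDeriv j ξ t := by
  intro δ hδ hδ1
  obtain ⟨C, hC, hb⟩ := h.powerBound_iteratedDeriv j δ hδ hδ1
  have hp : 0 ≤ ((1 + j : ℕ) : ℝ) - δ := by
    push_cast
    linarith [(Nat.cast_nonneg j : (0 : ℝ) ≤ j)]
  refine ⟨C * (2 + 2 * s ^ 2) ^ (((1 + j : ℕ) : ℝ) - δ) * |s|, by positivity, fun _ t => ?_⟩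
  have hder : ∀ y, HasDerivAt (iteratedDeriv j ξ) (iteratedDeriv j v y) y := by
    intro y
    rw [← h.deriv_eq, ← iteratedDeriv_succ', iteratedDeriv_succ]
    have hj : ((j : ℕ) : WithTop ℕ∞) < ∞ := by exact_mod_cast ENat.natCast_lt_top j
    exact (h.contDiff_chart.differentiable_iteratedDeriv j hj y).hasDerivAt
  have hmv := (convex_uIcc t (t + s)).norm_image_sub_le_of_norm_hasDerivWithin_le
    (f := iteratedDeriv j ξ) (f' := iteratedDeriv j v)
    (C := C * ((2 + 2 * s ^ 2) * v t) ^ (((1 + j : ℕ) : ℝ) - δ))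
    (fun y _ => (hder y).hasDerivWithinAt) (fun y hy => ?_) left_mem_uIcc right_mem_uIcc
  · rw [Real.mul_rpow (by positivity) (h.pos t).le, Real.norm_eq_abs, Real.norm_eq_abs,
      add_sub_cancel_left] at hmv
    refine hmv.trans (le_of_eq ?_)
    ring
  · refine (hb () y).trans (mul_le_mul_of_nonneg_left ?_ hC)
    refine Real.rpow_le_rpow (h.pos y).le ?_ hp
    have h1 := h.shift (y - t) t
    rw [add_sub_cancel] at h1
    refine h1.trans (mul_le_mul_of_nonneg_right ?_ (h.pos t).le)
    have h2 : |y - t| ≤ |s| := by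
      have := abs_sub_left_of_mem_uIcc hy
      simpa using this
    have := sq_le_sq.2 h2
    linarith

lemma symbol_density (N : ℕ) : SymbolUpTo (PowerBound v) N 1 fun _ => v :=
  symbol_of_iteratedDeriv h.contDiff h.powerBound_iteratedDeriv N

lemma symbol_difference (s : ℝ) (N : ℕ) :
    SymbolUpTo (PowerBound v) N 1 fun _ t => ξ (t + s) - ξ t := by
  have hs : ContDiff ℝ ∞ fun t => ξ (t + s) := h.contDiff_chart.comp (by fun_prop)
  refine symbol_of_iteratedDeriv (hs.sub h.contDiff_chart) (fun j => ?_) N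
  have : iteratedDeriv j (fun t => ξ (t + s) - ξ t) =
      fun t => iteratedDeriv j ξ (t + s) - iteratedDeriv j ξ t := by
    funext t
    rw [iteratedDeriv_fun_sub (hs.contDiffAt.of_le (by exact_mod_cast le_top))
      (h.contDiff_chart.contDiffAt.of_le (by exact_mod_cast le_top)), iteratedDeriv_comp_add_const]
  rw [this]
  exact h.powerBound_difference s j

/-- All iterated derivatives of the displacement of a translation, with respect to the
coordinate of the interval, tend to zero at the end points. -/
lemma exists_flat_displacement (s : ℝ) : ∃ G : ℕ → ℝ → ℝ, (∀ t, G 0 t = ξ (t + s) - ξ t) ∧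
    (∀ p t, HasDerivAt (G p) (v t * G (p + 1) t) t) ∧
    ∀ p, Tendsto (G p) (cocompact ℝ) (𝓝 0) := by
  have hB := isGradedBound_powerBound h.pos
  -- The interval derivative is `(1/v) d/dt`. By the quotient rule its `p`-th iterate is `A p / v ^
  -- (2p)`, and this recursion raises the order of the numerator by `2` each time.
  let A : ℕ → ℝ → ℝ := fun p => Nat.rec (fun t => ξ (t + s) - ξ t)
    (fun p f t => deriv f t * v t + (-(2 * p : ℝ)) * f t * deriv v t) p
  have hA : ∀ p N, SymbolUpTo (PowerBound v) N (1 + 2 * p) fun _ => A p := by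
    intro p
    induction p with
    | zero => exact h.symbol_difference s
    | succ p ih =>
      intro N
      -- Order `0` allows the bound `C * v ^ (-δ)`, which is bounded below since `v` is bounded; the
      -- latter is the derivative bound for `j = 0`, `δ = 1`.
      have hconst : SymbolUpTo (PowerBound v) N 0 fun _ _ => (-(2 * p : ℝ)) := by
        refine SymbolUpTo.const hB (c := fun _ => (-(2 * p : ℝ))) (fun δ hδ hδ1 => ?_) N
        obtain ⟨C, hC, hb⟩ := h.powerBound_iteratedDeriv 0 1 one_pos le_rfl
        obtain ⟨B, hB1, hB⟩ : ∃ B : ℝ, 0 < B ∧ ∀ t, v t ≤ B := by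
          refine ⟨C + 1, by linarith, fun t => ?_⟩
          have := (le_abs_self _).trans (hb () t)
          simp at this
          linarith
        refine ⟨2 * p * B ^ δ, by positivity, fun _ t => ?_⟩
        rw [abs_neg, abs_of_nonneg (by positivity : (0 : ℝ) ≤ 2 * p), mul_assoc]
        refine le_mul_of_one_le_right (by positivity) ?_
        rw [Nat.cast_zero, zero_sub, Real.rpow_neg (h.pos t).le, ← div_eq_mul_inv,
          one_le_div (Real.rpow_pos_of_pos (h.pos t) _)]
        exact Real.rpow_le_rpow (h.pos t).le (hB t) hδ.le
      have e1 := (ih (N + 1)).2.2.mul hB (h.symbol_density N)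
      have e2 := (hconst.mul hB (ih N)).mul hB (h.symbol_density (N + 1)).2.2
      have e3 : 0 + (1 + 2 * p) + (1 + 1) = 1 + 2 * p + 1 + 1 := by ring
      rw [e3] at e2
      exact e1.add hB e2
  have hvd : ∀ t, HasDerivAt v (deriv v t) t := fun t =>
    (h.contDiff.differentiable (by simp) t).hasDerivAt
  refine ⟨fun p t => A p t / v t ^ (2 * p), fun t => by simp [A], fun p t => ?_, fun p => ?_⟩
  · have hv := h.pos t
    have hAd : HasDerivAt (A p) (deriv (A p) t) t := ((hA p 1).2.1 () t).hasDerivAt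
    refine (hAd.div ((hvd t).fun_pow (2 * p)) (pow_ne_zero _ hv.ne')).congr_deriv ?_
    change _ = v t * ((deriv (A p) t * v t + (-(2 * p : ℝ)) * A p t * deriv v t) / _)
    -- The power rule contains the truncated exponent `2p - 1`, so `p = 0` is separate.
    rcases Nat.eq_zero_or_pos p with rfl | hp
    · simp
      field_simp
    · obtain ⟨r, hr⟩ : ∃ r, 2 * p = r + 1 := ⟨2 * p - 1, by omega⟩
      have hr' : (2 * p : ℝ) = r + 1 := by exact_mod_cast hr
      rw [show 2 * (p + 1) = r + 3 by omega, hr, hr']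
      simp only [Nat.add_sub_cancel, Nat.cast_add, Nat.cast_one]
      field_simp
      ring
  · obtain ⟨C, hC, hb⟩ := (hA p 0).bound (1 / 2) (by norm_num) (by norm_num)
    have hlim : Tendsto (fun t => C * v t ^ (1 / 2 : ℝ)) (cocompact ℝ) (𝓝 0) := by
      have := (h.tendsto_zero.rpow_const (p := 1 / 2) (Or.inr (by norm_num))).const_mul C
      simpa using this
    refine squeeze_zero_norm (fun t => ?_) hlim
    have hv := h.pos t
    rw [Real.norm_eq_abs, abs_div, abs_of_pos (pow_pos hv _), div_le_iff₀ (pow_pos hv _),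
      ← Real.rpow_natCast, mul_assoc, ← Real.rpow_add hv]
    rw [show (1 / 2 : ℝ) + ((2 * p : ℕ) : ℝ) = ((1 + 2 * p : ℕ) : ℝ) - 1 / 2 by push_cast; ring]
    exact hb () t

end IsFlowChart

/-! ### The translation flow on the interval. -/

/-- The translation by `s` of the line, transported to `(1/4, 3/4)` by `ξ` and extended by the
identity. -/
def flow (ξ : ℝ → ℝ) (s x : ℝ) : ℝ :=
  open Classical in if x ∈ Ioo (1 / 4 : ℝ) (3 / 4) then ξ (Function.invFun ξ x + s) else x

namespace IsFlowChart

variable {v ξ : ℝ → ℝ} (h : IsFlowChart v ξ)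
include h

lemma strictMono : StrictMono ξ :=
  strictMono_of_deriv_pos fun t => by rw [h.deriv_eq]; exact h.pos t

lemma invFun_apply (t : ℝ) : Function.invFun ξ (ξ t) = t :=
  Function.leftInverse_invFun h.strictMono.injective t

lemma mem_Ioo (t : ℝ) : ξ t ∈ Ioo (1 / 4 : ℝ) (3 / 4) :=
  ⟨(h.strictMono.monotone.le_of_tendsto h.atBot (t - 1)).trans_lt (h.strictMono (by linarith)),
    (h.strictMono (by linarith)).trans_le (h.strictMono.monotone.ge_of_tendsto h.atTop (t + 1))⟩

lemma exists_eq {x : ℝ} (hx : x ∈ Ioo (1 / 4 : ℝ) (3 / 4)) : ∃ t, ξ t = x :=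
  mem_range_of_exists_le_of_exists_ge h.contDiff_chart.continuous
    ((h.atBot.eventually (eventually_le_nhds hx.1)).exists)
    ((h.atTop.eventually (eventually_ge_nhds hx.2)).exists)

lemma flow_chart (s t : ℝ) : flow ξ s (ξ t) = ξ (t + s) := by
  rw [flow, if_pos (h.mem_Ioo t), h.invFun_apply]

omit h in
lemma flow_of_notMem (s : ℝ) {x : ℝ} (hx : x ∉ Ioo (1 / 4 : ℝ) (3 / 4)) : flow ξ s x = x :=
  if_neg hx

lemma flow_flow (s r x : ℝ) : flow ξ s (flow ξ r x) = flow ξ (s + r) x := by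
  by_cases hx : x ∈ Ioo (1 / 4 : ℝ) (3 / 4)
  · obtain ⟨t, rfl⟩ := h.exists_eq hx
    rw [h.flow_chart, h.flow_chart, h.flow_chart]
    ring_nf
  · rw [flow_of_notMem r hx, flow_of_notMem s hx, flow_of_notMem _ hx]

lemma flow_zero (x : ℝ) : flow ξ 0 x = x := by
  by_cases hx : x ∈ Ioo (1 / 4 : ℝ) (3 / 4)
  · obtain ⟨t, rfl⟩ := h.exists_eq hx
    rw [h.flow_chart, add_zero]
  · exact flow_of_notMem 0 hx

/-- The maps `flow ξ s` as permutations of the line. -/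
def flowPerm (s : ℝ) : Equiv.Perm ℝ where
  toFun := flow ξ s
  invFun := flow ξ (-s)
  left_inv x := by rw [h.flow_flow, neg_add_cancel, h.flow_zero]
  right_inv x := by rw [h.flow_flow, add_neg_cancel, h.flow_zero]

lemma flowPerm_apply (s x : ℝ) : h.flowPerm s x = flow ξ s x := rfl

lemma flowPerm_pow (s : ℝ) (n : ℕ) : h.flowPerm s ^ n = h.flowPerm (n * s) := by
  induction n with
  | zero =>
    ext x
    simp [flowPerm_apply, h.flow_zero]
  | succ n ih =>
    ext x
    rw [pow_succ', ih, Equiv.Perm.mul_apply, flowPerm_apply, flowPerm_apply, flowPerm_apply,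
      h.flow_flow]
    push_cast
    ring_nf

lemma flowPerm_inv (s : ℝ) : (h.flowPerm s)⁻¹ = h.flowPerm (-s) := by
  ext x
  rfl

lemma hasDerivAt_invFun (t : ℝ) : HasDerivAt (Function.invFun ξ) (v t)⁻¹ (ξ t) := by
  have hmono : StrictMonoOn (Function.invFun ξ) (Ioo (1 / 4 : ℝ) (3 / 4)) := by
    intro x hx y hy hxy
    obtain ⟨a, rfl⟩ := h.exists_eq hx
    obtain ⟨b, rfl⟩ := h.exists_eq hy
    rw [h.invFun_apply, h.invFun_apply]
    exact h.strictMono.lt_iff_lt.1 hxy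
  have hnhds : Ioo (1 / 4 : ℝ) (3 / 4) ∈ 𝓝 (ξ t) := isOpen_Ioo.mem_nhds (h.mem_Ioo t)
  have hcont : ContinuousAt (Function.invFun ξ) (ξ t) := by
    refine hmono.continuousAt_of_image_mem_nhds hnhds ?_
    convert univ_mem
    refine eq_univ_of_forall fun a => ⟨ξ a, h.mem_Ioo a, h.invFun_apply a⟩
  refine HasDerivAt.of_local_left_inverse (f := ξ) hcont ?_ (h.pos t).ne' ?_
  · rw [h.invFun_apply]
    exact h.hasDerivAt t
  · filter_upwards [hnhds] with y hy
    obtain ⟨a, rfl⟩ := h.exists_eq hy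
    rw [h.invFun_apply]

/-- The displacement `flow ξ s x - x`, read in the chart, is `G 0`, and its successive derivatives
in `x` are the `G p`, which die at both ends. So it glues smoothly with `0`. -/
lemma flow_smooth (s : ℝ) : ContDiff ℝ ∞ (flow ξ s) ∧
    (∀ t, HasDerivAt (flow ξ s) (v (t + s) / v t) (ξ t)) ∧
    ∀ x ∉ Ioo (1 / 4 : ℝ) (3 / 4), HasDerivAt (flow ξ s) 1 x := by
  classical
  obtain ⟨G, hG0, hG, hGt⟩ := h.exists_flat_displacement s
  have hin : ∀ p t, HasDerivAt (fun x => G p (Function.invFun ξ x)) (G (p + 1) t) (ξ t) := by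
    intro p t
    have h1 : HasDerivAt (G p) (v t * G (p + 1) t) (Function.invFun ξ (ξ t)) := by
      rw [h.invFun_apply]
      exact hG p t
    refine (h1.comp (ξ t) (h.hasDerivAt_invFun t)).congr_deriv ?_
    have := (h.pos t).ne'
    field_simp
  set F : ℕ → ℝ → ℝ := fun p x =>
    if x ∈ Ioo (1 / 4 : ℝ) (3 / 4) then G p (Function.invFun ξ x) else 0 with hF
  have hFξ : ∀ p t, F p (ξ t) = G p t := fun p t => by
    simp only [hF]
    rw [if_pos (h.mem_Ioo t), h.invFun_apply]
  have key := contDiff_of_flat (F := F) (a := 1 / 4) (b := 3 / 4) (by norm_num)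
    (fun p x hx => if_neg hx) (fun p x hx => ?_) (fun p => ?_) (fun p => ?_)
  · have hflow : flow ξ s = fun x => x + F 0 x := by
      funext x
      by_cases hx : x ∈ Ioo (1 / 4 : ℝ) (3 / 4)
      · obtain ⟨t, rfl⟩ := h.exists_eq hx
        rw [h.flow_chart, hFξ, hG0]
        ring
      · rw [flow_of_notMem s hx]
        simp only [hF]
        rw [if_neg hx, add_zero]
    have hd : ∀ x, HasDerivAt (flow ξ s) (1 + F 1 x) x := fun x => by
      rw [hflow]
      exact (hasDerivAt_id' x).add (key.1 0 x)
    refine ⟨?_, fun t => ?_, fun x hx => ?_⟩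
    · rw [hflow]
      exact contDiff_id.add key.2
    · refine (hd (ξ t)).congr_deriv ?_
      have e1 := hG 0 t
      have e2 : HasDerivAt (G 0) (v (t + s) - v t) t := by
        rw [funext hG0]
        exact ((h.hasDerivAt (t + s)).comp_add_const t s).sub (h.hasDerivAt t)
      have e3 := e1.unique e2
      have := (h.pos t).ne'
      rw [hFξ, eq_div_iff this]
      linear_combination e3
    · refine (hd x).congr_deriv ?_
      simp only [hF]
      rw [if_neg hx, add_zero]
  · obtain ⟨t, rfl⟩ := h.exists_eq hx
    rw [hFξ]
    refine (hin p t).congr_of_eventuallyEq ?_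
    filter_upwards [isOpen_Ioo.mem_nhds hx] with y hy
    exact if_pos hy
  · rw [Metric.tendsto_nhds]
    intro ε hε
    have h1 := ((hGt p).mono_left atBot_le_cocompact).eventually (Metric.ball_mem_nhds 0 hε)
    obtain ⟨T, hT⟩ := eventually_atBot.1 h1
    filter_upwards [Ioo_mem_nhdsGT (h.mem_Ioo T).1] with x hx
    obtain ⟨t, rfl⟩ := h.exists_eq ⟨hx.1, hx.2.trans (h.mem_Ioo T).2⟩
    rw [hFξ]
    exact hT t (h.strictMono.lt_iff_lt.1 hx.2).le
  · rw [Metric.tendsto_nhds]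
    intro ε hε
    have h1 := ((hGt p).mono_left atTop_le_cocompact).eventually (Metric.ball_mem_nhds 0 hε)
    obtain ⟨T, hT⟩ := eventually_atTop.1 h1
    filter_upwards [Ioo_mem_nhdsLT (h.mem_Ioo T).2] with x hx
    obtain ⟨t, rfl⟩ := h.exists_eq ⟨(h.mem_Ioo T).1.trans hx.1, hx.2⟩
    rw [hFξ]
    exact hT t (h.strictMono.lt_iff_lt.1 hx.1).le

lemma lipschitzWith_flow {s : ℝ} {M : NNReal} (hM : 1 ≤ M) (hs : ∀ t, v (t + s) ≤ M * v t) :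
    LipschitzWith M (flow ξ s) := by
  obtain ⟨hsm, hin, hout⟩ := h.flow_smooth s
  refine lipschitzWith_of_nnnorm_deriv_le (hsm.differentiable (by simp)) fun x => ?_
  rw [← NNReal.coe_le_coe, coe_nnnorm, Real.norm_eq_abs]
  by_cases hx : x ∈ Ioo (1 / 4 : ℝ) (3 / 4)
  · obtain ⟨t, rfl⟩ := h.exists_eq hx
    rw [(hin t).deriv, abs_of_pos (div_pos (h.pos _) (h.pos t)), div_le_iff₀ (h.pos t)]
    exact hs t
  · rw [(hout x hx).deriv, abs_one]
    exact_mod_cast hM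

lemma deriv_flow_pos (s x : ℝ) : 0 < deriv (flow ξ s) x := by
  obtain ⟨hsm, hin, hout⟩ := h.flow_smooth s
  by_cases hx : x ∈ Ioo (1 / 4 : ℝ) (3 / 4)
  · obtain ⟨t, rfl⟩ := h.exists_eq hx
    rw [(hin t).deriv]
    exact div_pos (h.pos _) (h.pos t)
  · rw [(hout x hx).deriv]
    exact one_pos

end IsFlowChart

/-! ### From Lipschitz bounds and a wandering orbit to irregular growth. -/

section Growth

variable {E : Type*} [NormedAddCommGroup E] [NormedSpace ℝ E] {s : Set E}

omit [NormedAddCommGroup E] [NormedSpace ℝ E] in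
lemma toMap_subtypePerm (e : Equiv.Perm E) (he : ∀ x, e x ∈ s ↔ x ∈ s) {x : E} (hx : x ∈ s) :
    toMap (e.subtypePerm he : Equiv.Perm s) x = e x := by
  rw [toMap, dif_pos hx]
  rfl

lemma isDiffeo_subtypePerm {n : WithTop ℕ∞} {e : Equiv.Perm E} (he : ∀ x, e x ∈ s ↔ x ∈ s)
    (h1 : ContDiff ℝ n e) (h2 : ContDiff ℝ n e.symm) :
    IsDiffeo n (e.subtypePerm he : Equiv.Perm s) := by
  have he' : ∀ x, (e⁻¹ : Equiv.Perm E) x ∈ s ↔ x ∈ s := fun x => by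
    rw [← he, show e ((e⁻¹ : Equiv.Perm E) x) = x from e.apply_symm_apply x]
  have hinv : (e.subtypePerm he : Equiv.Perm s)⁻¹ = (e⁻¹).subtypePerm he' :=
    (Equiv.Perm.subtypePerm_inv e he').symm
  refine ⟨h1.contDiffOn.congr fun x hx => toMap_subtypePerm e he hx, ?_⟩
  rw [hinv]
  exact h2.contDiffOn.congr fun x hx => toMap_subtypePerm _ he' hx

lemma fderivWithin_toMap_subtypePerm (hu : UniqueDiffOn ℝ s) {e : Equiv.Perm E}
    (he : ∀ x, e x ∈ s ↔ x ∈ s) (h1 : Differentiable ℝ e) {x : E} (hx : x ∈ s) :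
    fderivWithin ℝ (toMap (e.subtypePerm he : Equiv.Perm s)) s x = fderiv ℝ e x := by
  rw [fderivWithin_congr (fun y hy => toMap_subtypePerm e he hy) (toMap_subtypePerm e he hx)]
  exact (h1 x).fderivWithin (hu x hx)

lemma maxDiff_le (hu : UniqueDiffOn ℝ s) (hne : s.Nonempty) {e : Equiv.Perm E}
    (he : ∀ x, e x ∈ s ↔ x ∈ s) (h1 : Differentiable ℝ e) {M : NNReal} (hM : LipschitzWith M e) :
    maxDiff (e.subtypePerm he : Equiv.Perm s) ≤ M := by
  have : Nonempty s := hne.to_subtype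
  refine ciSup_le fun x => ?_
  rw [fderivWithin_toMap_subtypePerm hu he h1 x.2]
  exact norm_fderiv_le_of_lipschitz ℝ hM

lemma norm_sub_le_maxDiff (hu : UniqueDiffOn ℝ s) (hc : IsCompact s) (hconv : Convex ℝ s)
    {e : Equiv.Perm E} (he : ∀ x, e x ∈ s ↔ x ∈ s) (h1 : ContDiff ℝ 1 e) {x y : E} (hx : x ∈ s)
    (hy : y ∈ s) :
    ‖e y - e x‖ ≤ maxDiff (e.subtypePerm he : Equiv.Perm s) * ‖y - x‖ := by
  have hdiff : Differentiable ℝ e := h1.differentiable (by simp)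
  refine hconv.norm_image_sub_le_of_norm_fderivWithin_le (𝕜 := ℝ) hdiff.differentiableOn
    (fun z hz => ?_) hx hy
  have hbdd : BddAbove (range fun z : s =>
      ‖fderivWithin ℝ (toMap (e.subtypePerm he : Equiv.Perm s)) s (z : E)‖) := by
    obtain ⟨B, hB⟩ := (hc.image (h1.continuous_fderiv (by simp)).norm).bddAbove
    refine ⟨B, ?_⟩
    rintro _ ⟨z, rfl⟩
    simp only
    rw [fderivWithin_toMap_subtypePerm hu he hdiff z.2]
    exact hB ⟨z, z.2, rfl⟩
  have := le_ciSup hbdd ⟨z, hz⟩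
  simp only [fderivWithin_toMap_subtypePerm hu he hdiff hz] at this
  rw [(hdiff z).fderivWithin (hu z hz)]
  exact this

lemma contDiff_perm_pow {n : WithTop ℕ∞} {e : Equiv.Perm E} (h : ContDiff ℝ n e) (k : ℕ) :
    ContDiff ℝ n (e ^ k : Equiv.Perm E) := by
  induction k with
  | zero => exact contDiff_id
  | succ k ih =>
    rw [pow_succ', Equiv.Perm.coe_mul]
    exact h.comp ih

/-- A diffeomorphism of a compact convex set with a wandering orbit of finite length has summable
inverse growth; if some iterates have small Lipschitz constants, the growth is irregular. -/
theorem hasIrregularGrowth_subtypePerm (hu : UniqueDiffOn ℝ s) (hc : IsCompact s)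
    (hconv : Convex ℝ s) {e : Equiv.Perm E} (he : ∀ x, e x ∈ s ↔ x ∈ s) (h1 : ContDiff ℝ 1 e)
    (h2 : ContDiff ℝ 1 e.symm) {u : ℕ → ℝ} {q : ℕ → ℕ} {M : ℕ → NNReal}
    (hL : ∀ k, LipschitzWith (M k) (e ^ q k : Equiv.Perm E))
    (hL' : ∀ k, LipschitzWith (M k) ((e ^ q k)⁻¹ : Equiv.Perm E))
    (hq : ∀ k, k ≤ q k) (hu0 : ∀ k, 0 < u (q k)) (hM : ∀ k, M k ≤ u (q k))
    {x₀ : E} (hx₀ : x₀ ∈ s) (hne : e x₀ ≠ x₀)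
    (hsum : Summable fun n : ℕ => ‖(e ^ n) x₀ - (e ^ (n + 1)) x₀‖) :
    HasIrregularGrowth u (e.subtypePerm he : Equiv.Perm s) := by
  have hpow : ∀ (n : ℕ) x, (e ^ n) x ∈ s ↔ x ∈ s := fun n => by
    induction n with
    | zero => simp
    | succ n ih =>
      intro x
      rw [pow_succ', Equiv.Perm.mul_apply, he, ih]
  have hpow' : ∀ (n : ℕ) x, ((e ^ n)⁻¹ : Equiv.Perm E) x ∈ s ↔ x ∈ s := fun n x => by
    rw [← hpow n, show (e ^ n) (((e ^ n)⁻¹ : Equiv.Perm E) x) = x from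
      (e ^ n).apply_symm_apply x]
  have e1 : ∀ n : ℕ, (e.subtypePerm he : Equiv.Perm s) ^ n = (e ^ n).subtypePerm (hpow n) :=
    fun n => Equiv.Perm.subtypePerm_pow e n he
  have e2 : ∀ n : ℕ, ((e.subtypePerm he : Equiv.Perm s) ^ n)⁻¹ =
      ((e ^ n)⁻¹).subtypePerm (hpow' n) := fun n => by
    rw [e1]
    exact (Equiv.Perm.subtypePerm_inv (e ^ n) (hpow' n)).symm
  have s1 : ∀ n : ℕ, ContDiff ℝ 1 (e ^ n : Equiv.Perm E) := contDiff_perm_pow h1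
  have s2 : ∀ n : ℕ, ContDiff ℝ 1 ((e ^ n)⁻¹ : Equiv.Perm E) := fun n => by
    rw [← inv_pow]
    exact contDiff_perm_pow h2 n
  constructor
  · refine liminf_le_of_frequently_le' (frequently_atTop.2 fun k => ⟨q k, hq k, ?_⟩)
    have : growth (e.subtypePerm he : Equiv.Perm s) (q k) / u (q k) ≤ 1 := by
      rw [div_le_one (hu0 k)]
      refine (max_le ?_ ?_).trans (hM k)
      · rw [e1]
        exact maxDiff_le hu ⟨x₀, hx₀⟩ _ ((s1 _).differentiable (by simp)) (hL k)
      · rw [e2]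
        exact maxDiff_le hu ⟨x₀, hx₀⟩ _ ((s2 _).differentiable (by simp)) (hL' k)
    exact_mod_cast this
  · have hD : 0 < ‖x₀ - e x₀‖ := norm_pos_iff.2 (sub_ne_zero.2 hne.symm)
    have key : ∀ n : ℕ, ‖x₀ - e x₀‖ ≤
        growth (e.subtypePerm he : Equiv.Perm s) n * ‖(e ^ n) x₀ - (e ^ (n + 1)) x₀‖ := by
      intro n
      -- The inverse iterate carries the `n`-th gap of the orbit back to the gap between `x₀` and `e
      -- x₀`; convexity allows the mean value inequality.
      have := norm_sub_le_maxDiff hu hc hconv (hpow' n) (s2 n) (x := (e ^ (n + 1)) x₀)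
        (y := (e ^ n) x₀) ((hpow _ _).2 hx₀) ((hpow _ _).2 hx₀)
      have hinv : ∀ y, ((e ^ n)⁻¹ : Equiv.Perm E) ((e ^ n) y) = y := (e ^ n).symm_apply_apply
      rw [← e2, hinv, pow_succ, Equiv.Perm.mul_apply, hinv] at this
      rw [pow_succ, Equiv.Perm.mul_apply]
      exact this.trans (mul_le_mul_of_nonneg_right (le_max_right _ _) (norm_nonneg _))
    have hpos : ∀ n : ℕ, 0 < growth (e.subtypePerm he : Equiv.Perm s) n := fun n =>
      pos_of_mul_pos_left (hD.trans_le (key n)) (norm_nonneg _)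
    refine (((summable_nat_add_iff 1).2 hsum).mul_right ‖x₀ - e x₀‖⁻¹).of_nonneg_of_le
      (fun n => (one_div_pos.2 (hpos _)).le) fun n => ?_
    rw [← div_eq_mul_inv, div_le_div_iff₀ (hpos _) hD, one_mul, mul_comm]
    exact key (n + 1)

end Growth

/-! ### Line diffeomorphisms supported in the middle of the interval. -/

/-- Diffeomorphisms of the line which are the identity off `(1/4, 3/4)`. -/
structure IsLineDiffeo (φ : Equiv.Perm ℝ) : Prop where
  contDiff : ContDiff ℝ ∞ φ
  deriv_pos : ∀ x, 0 < deriv φ x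
  eq_self : ∀ x ∉ Ioo (1 / 4 : ℝ) (3 / 4), φ x = x

namespace IsLineDiffeo

variable {φ ψ : Equiv.Perm ℝ} (h : IsLineDiffeo φ)
include h

lemma contDiff_symm : ContDiff ℝ ∞ φ.symm := by
  have hm : StrictMono φ := strictMono_of_deriv_pos h.deriv_pos
  let e : ℝ ≃ₜ ℝ := (hm.orderIsoOfSurjective φ φ.surjective).toHomeomorph
  have he : ⇑e.symm = φ.symm := by
    funext x
    apply φ.injective
    rw [Equiv.apply_symm_apply]
    exact e.apply_symm_apply x
  rw [← he]
  exact e.contDiff_symm_deriv (fun x => (h.deriv_pos x).ne')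
    (fun x => (h.contDiff.differentiable (by simp) x).hasDerivAt) h.contDiff

lemma apply_mem_Ioo {x : ℝ} (hx : x ∈ Ioo (1 / 4 : ℝ) (3 / 4)) : φ x ∈ Ioo (1 / 4 : ℝ) (3 / 4) := by
  by_contra hn
  have := φ.injective (h.eq_self _ hn)
  rw [this] at hn
  exact hn hx

lemma symm_eq_self : ∀ x ∉ Ioo (1 / 4 : ℝ) (3 / 4), φ.symm x = x := fun x hx => by
  rw [Equiv.symm_apply_eq, h.eq_self x hx]

lemma apply_nonneg {x : ℝ} (hx : 0 ≤ x) : 0 ≤ φ x := by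
  by_cases h' : x ∈ Ioo (1 / 4 : ℝ) (3 / 4)
  · have := (h.apply_mem_Ioo h').1
    linarith
  · rwa [h.eq_self x h']

lemma apply_pos {x : ℝ} (hx : 0 < x) : 0 < φ x := by
  by_cases h' : x ∈ Ioo (1 / 4 : ℝ) (3 / 4)
  · have := (h.apply_mem_Ioo h').1
    linarith
  · rwa [h.eq_self x h']

lemma apply_zero : φ 0 = 0 := h.eq_self 0 (by simp)

lemma apply_le_one_iff {x : ℝ} : φ x ≤ 1 ↔ x ≤ 1 := by
  by_cases h' : x ∈ Ioo (1 / 4 : ℝ) (3 / 4)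
  · have := (h.apply_mem_Ioo h').2
    have := h'.2
    constructor <;> intro _ <;> linarith
  · rw [h.eq_self x h']

lemma apply_nonneg_iff {x : ℝ} : 0 ≤ φ x ↔ 0 ≤ x := by
  by_cases h' : x ∈ Ioo (1 / 4 : ℝ) (3 / 4)
  · have := (h.apply_mem_Ioo h').1
    have := h'.1
    constructor <;> intro _ <;> linarith
  · rw [h.eq_self x h']

lemma symm : IsLineDiffeo φ.symm where
  contDiff := h.contDiff_symm
  deriv_pos x := by
    have h1 : HasDerivAt φ (deriv φ (φ.symm x)) (φ.symm x) :=
      (h.contDiff.differentiable (by simp) _).hasDerivAt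
    have h2 : HasDerivAt φ.symm (deriv φ.symm x) x :=
      (h.contDiff_symm.differentiable (by simp) _).hasDerivAt
    have h3 := h1.comp x h2
    have h4 : φ ∘ φ.symm = id := by
      funext y
      simp
    rw [h4] at h3
    have h5 := h3.unique (hasDerivAt_id x)
    exact pos_of_mul_pos_right (h5 ▸ one_pos) (h.deriv_pos _).le
  eq_self := h.symm_eq_self

/-- The linear isotopy from the identity consists of diffeomorphisms. -/
lemma exists_linear_isotopy {t : ℝ} (ht : t ∈ Icc (0 : ℝ) 1) :
    ∃ ψ : Equiv.Perm ℝ, IsLineDiffeo ψ ∧ ∀ x, ψ x = (1 - t) * x + t * φ x := by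
  have hd : ∀ x, HasDerivAt (fun x => (1 - t) * x + t * φ x) ((1 - t) + t * deriv φ x) x := by
    intro x
    have h1 := ((hasDerivAt_id' x).const_mul (1 - t)).fun_add
      (((h.contDiff.differentiable (by simp) x).hasDerivAt).const_mul t)
    rwa [mul_one] at h1
  have hpos : ∀ x, 0 < (1 - t) + t * deriv φ x := by
    intro x
    have h1 := h.deriv_pos x
    rcases ht.1.eq_or_lt with rfl | h0
    · simp
    · have := mul_pos h0 h1
      linarith [ht.2]
  have hdp : ∀ x, 0 < deriv (fun x => (1 - t) * x + t * φ x) x := fun x => by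
    rw [(hd x).deriv]
    exact hpos x
  have hself : ∀ x ∉ Ioo (1 / 4 : ℝ) (3 / 4), (1 - t) * x + t * φ x = x := fun x hx => by
    rw [h.eq_self x hx]
    ring
  have hsm : ContDiff ℝ ∞ fun x => (1 - t) * x + t * φ x :=
    (contDiff_const.mul contDiff_id).add (contDiff_const.mul h.contDiff)
  have hm : StrictMono fun x => (1 - t) * x + t * φ x := strictMono_of_deriv_pos hdp
  have hsurj : Function.Surjective fun x => (1 - t) * x + t * φ x := by
    refine hsm.continuous.surjective ?_ ?_
    · refine tendsto_id.congr' ?_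
      filter_upwards [eventually_ge_atTop (1 : ℝ)] with x hx
      exact (hself x fun hx' => by linarith [hx'.2]).symm
    · refine tendsto_id.congr' ?_
      filter_upwards [eventually_le_atBot (0 : ℝ)] with x hx
      exact (hself x fun hx' => by linarith [hx'.1]).symm
  exact ⟨Equiv.ofBijective _ ⟨hm.injective, hsurj⟩, ⟨hsm, hdp, hself⟩, fun x => rfl⟩

end IsLineDiffeo

/-! ### Radial extensions. -/

section Radial

variable {E : Type*} [NormedAddCommGroup E] [InnerProductSpace ℝ E] (c : E) (r : ℝ)

/-- The radial extension of a function `f` of the normalized radius. -/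
def radial (f : ℝ → ℝ) (x : E) : E := c + (r * f (‖x - c‖ / r) / ‖x - c‖) • (x - c)

lemma radial_of_eq_self (hr : 0 < r) {f : ℝ → ℝ} {x : E} (hf : f (‖x - c‖ / r) = ‖x - c‖ / r) :
    radial c r f x = x := by
  rw [radial, hf, mul_div_cancel₀ _ hr.ne']
  rcases eq_or_ne x c with rfl | hx
  · simp
  · rw [div_self (norm_ne_zero_iff.2 (sub_ne_zero.2 hx)), one_smul, add_sub_cancel]

lemma radial_id (hr : 0 < r) (x : E) : radial c r id x = x := radial_of_eq_self c r hr rfl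

lemma norm_radial_sub (hr : 0 < r) {f : ℝ → ℝ} (hf : ∀ x, 0 ≤ x → 0 ≤ f x) (hf0 : f 0 = 0)
    (x : E) : ‖radial c r f x - c‖ = r * f (‖x - c‖ / r) := by
  have h0 := hf (‖x - c‖ / r) (by positivity)
  rw [radial, add_sub_cancel_left, norm_smul, Real.norm_of_nonneg (by positivity)]
  rcases eq_or_ne x c with rfl | hx
  · simp [hf0]
  · rw [div_mul_cancel₀ _ (norm_ne_zero_iff.2 (sub_ne_zero.2 hx))]

lemma radial_radial (hr : 0 < r) {f g : ℝ → ℝ} (hg : ∀ x, 0 < x → 0 < g x) (hg0 : g 0 = 0)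
    (x : E) : radial c r f (radial c r g x) = radial c r (f ∘ g) x := by
  have hg' : ∀ x, 0 ≤ x → 0 ≤ g x := fun x hx => by
    rcases hx.eq_or_lt with rfl | hx
    · rw [hg0]
    · exact (hg x hx).le
  rw [radial, norm_radial_sub c r hr hg' hg0, mul_div_cancel_left₀ _ hr.ne']
  rcases eq_or_ne x c with rfl | hx
  · simp [radial]
  · have hn : 0 < ‖x - c‖ := norm_pos_iff.2 (sub_ne_zero.2 hx)
    have hgp := hg (‖x - c‖ / r) (by positivity)
    rw [radial, radial, add_sub_cancel_left, smul_smul, Function.comp_apply]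
    congr 2
    field_simp

variable {c r}

/-- The norm is singular only at the centre, and there the extension is the identity on the ball of
radius `r / 4`. -/
lemma contDiff_radial (hr : 0 < r) {φ : Equiv.Perm ℝ} (h : IsLineDiffeo φ) :
    ContDiff ℝ ∞ (radial c r φ) := by
  rw [contDiff_iff_contDiffAt]
  intro x
  rcases eq_or_ne x c with rfl | hx
  · refine contDiffAt_id.congr_of_eventuallyEq ?_
    filter_upwards [Metric.ball_mem_nhds x (show 0 < r / 4 by positivity)] with y hy
    refine radial_of_eq_self x r hr (h.eq_self _ fun hy' => ?_)
    rw [mem_ball_iff_norm] at hy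
    have := hy'.1
    rw [lt_div_iff₀ hr] at this
    linarith
  · have hx' : x - c ≠ 0 := sub_ne_zero.2 hx
    have hn : ContDiffAt ℝ ∞ (fun x => ‖x - c‖) x :=
      (contDiffAt_id.sub contDiffAt_const).norm ℝ hx'
    have h1 : ContDiffAt ℝ ∞ (fun x => φ (‖x - c‖ / r)) x :=
      h.contDiff.contDiffAt.comp x (hn.div_const r)
    unfold radial
    exact contDiffAt_const.add (((contDiffAt_const.mul h1).div hn (norm_ne_zero_iff.2 hx')).smul
      (contDiffAt_id.sub contDiffAt_const))

/-- The radial extension of a Lipschitz function vanishing at the origin is Lipschitz with the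
same constant. -/
lemma lipschitzWith_radial (hr : 0 < r) {f : ℝ → ℝ} (hf : ∀ x, 0 ≤ x → 0 ≤ f x) (hf0 : f 0 = 0)
    {M : NNReal} (hM : LipschitzWith M f) : LipschitzWith M (radial c r f : E → E) := by
  refine LipschitzWith.of_dist_le_mul fun x y => ?_
  have hlin : ∀ a b : ℝ, 0 ≤ a → 0 ≤ b → |r * f (a / r) - r * f (b / r)| ≤ M * |a - b| := by
    intro a b ha hb
    have := hM.dist_le_mul (a / r) (b / r)
    rw [Real.dist_eq, Real.dist_eq, ← sub_div, abs_div, abs_of_pos hr] at this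
    rw [← mul_sub, abs_mul, abs_of_pos hr]
    calc r * |f (a / r) - f (b / r)| ≤ r * (M * (|a - b| / r)) :=
          mul_le_mul_of_nonneg_left this hr.le
      _ = M * |a - b| := by field_simp
  have hcone : ∀ a : ℝ, 0 ≤ a → 0 ≤ r * f (a / r) ∧ r * f (a / r) ≤ M * a := by
    intro a ha
    have h1 := hlin a 0 ha le_rfl
    rw [zero_div, hf0, mul_zero, sub_zero, sub_zero, abs_of_nonneg ha] at h1
    exact ⟨mul_nonneg hr.le (hf _ (by positivity)), (le_abs_self _).trans h1⟩
  have hd : ∀ z : E, ∃ w : E, z = ‖z‖ • w ∧ (z ≠ 0 → ‖w‖ = 1) ∧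
      ∀ b : ℝ, (b / ‖z‖) • z = b • w := by
    intro z
    refine ⟨(‖z‖)⁻¹ • z, ?_, ?_, fun b => ?_⟩
    · rcases eq_or_ne z 0 with rfl | hz
      · simp
      · rw [smul_smul, mul_inv_cancel₀ (norm_ne_zero_iff.2 hz), one_smul]
    · intro hz
      rw [norm_smul, norm_inv, norm_norm, inv_mul_cancel₀ (norm_ne_zero_iff.2 hz)]
    · rw [smul_smul, div_eq_mul_inv]
  -- Squared distance splits into a radial part, which the Lipschitz bound controls, and an angular
  -- part with factor `p * s`, controlled by `f ρ ≤ M ρ`. Both grow by at most `M²`.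
  have polar : ∀ (p s : ℝ) (w z : E), ‖w‖ = 1 → ‖z‖ = 1 →
      ‖p • w - s • z‖ ^ 2 = (p - s) ^ 2 + p * s * ‖w - z‖ ^ 2 := by
    intro p s w z hw hz
    rw [norm_sub_sq_real, norm_sub_sq_real, norm_smul, norm_smul, inner_smul_left, inner_smul_right,
      hw, hz]
    simp only [Real.norm_eq_abs, mul_one, sq_abs, conj_trivial]
    ring
  have hc : ∀ z : E, dist (radial c r f z) c ≤ M * ‖z - c‖ := fun z => by
    rw [dist_eq_norm, norm_radial_sub c r hr hf hf0]
    exact (hcone _ (norm_nonneg _)).2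
  have hcc : radial c r f c = c := by simp [radial]
  rcases eq_or_ne x c with rfl | hx
  · rw [hcc, dist_comm, dist_comm x y, dist_eq_norm y x]
    exact hc y
  rcases eq_or_ne y c with rfl | hy
  · rw [hcc, dist_eq_norm x y]
    exact hc x
  obtain ⟨w, hw, hw1, hw2⟩ := hd (x - c)
  obtain ⟨z, hz, hz1, hz2⟩ := hd (y - c)
  have hw1 := hw1 (sub_ne_zero.2 hx)
  have hz1 := hz1 (sub_ne_zero.2 hy)
  have hA := hcone _ (norm_nonneg (x - c))
  have hB := hcone _ (norm_nonneg (y - c))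
  have hAB := hlin _ _ (norm_nonneg (x - c)) (norm_nonneg (y - c))
  rw [dist_eq_norm, dist_eq_norm, radial, radial, add_sub_add_left_eq_sub, hw2, hz2,
    ← sub_sub_sub_cancel_right x y c]
  refine abs_le_of_sq_le_sq' ?_ (by positivity) |>.2
  rw [mul_pow, polar _ _ _ _ hw1 hz1]
  conv_rhs => rw [hw, hz, polar _ _ _ _ hw1 hz1]
  have h1 : (r * f (‖x - c‖ / r) - r * f (‖y - c‖ / r)) ^ 2 ≤
      (M : ℝ) ^ 2 * (‖x - c‖ - ‖y - c‖) ^ 2 := by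
    rw [← mul_pow]
    refine sq_le_sq.2 (hAB.trans (le_of_eq ?_))
    rw [abs_mul, abs_of_nonneg M.coe_nonneg]
  have h2 : r * f (‖x - c‖ / r) * (r * f (‖y - c‖ / r)) ≤
      (M * ‖x - c‖) * (M * ‖y - c‖) := mul_le_mul hA.2 hB.2 hB.1 (by positivity)
  have h3 := mul_le_mul_of_nonneg_right h2 (sq_nonneg ‖w - z‖)
  linarith

/-- The radial extension of a diffeomorphism, as a permutation of the space. -/
def radialPerm (hr : 0 < r) {φ : Equiv.Perm ℝ} (h : IsLineDiffeo φ) : Equiv.Perm E where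
  toFun := radial c r φ
  invFun := radial c r φ.symm
  left_inv x := by
    rw [radial_radial c r hr (fun _ => h.apply_pos) h.apply_zero, Equiv.symm_comp_self,
      radial_id c r hr]
  right_inv x := by
    rw [radial_radial c r hr (fun _ => h.symm.apply_pos) h.symm.apply_zero, Equiv.self_comp_symm,
      radial_id c r hr]

lemma radialPerm_pow (hr : 0 < r) {φ : Equiv.Perm ℝ} (h : IsLineDiffeo φ) (n : ℕ) (x : E) :
    (radialPerm (c := c) hr h ^ n) x = radial c r (φ ^ n : Equiv.Perm ℝ) x := by
  induction n generalizing x with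
  | zero => exact (radial_id c r hr x).symm
  | succ n ih =>
    rw [pow_succ, Equiv.Perm.mul_apply, ih]
    change radial c r _ (radial c r φ x) = _
    rw [radial_radial c r hr (fun _ => h.apply_pos) h.apply_zero, pow_succ]
    rfl

lemma radialPerm_inv (hr : 0 < r) {φ : Equiv.Perm ℝ} (h : IsLineDiffeo φ) :
    (radialPerm (c := c) hr h)⁻¹ = radialPerm (c := c) hr h.symm := by
  ext x
  rfl

lemma radial_mem_closedBall (hr : 0 < r) {φ : Equiv.Perm ℝ} (h : IsLineDiffeo φ) (x : E) :
    radialPerm (c := c) hr h x ∈ Metric.closedBall c r ↔ x ∈ Metric.closedBall c r := by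
  rw [mem_closedBall_iff_norm, mem_closedBall_iff_norm]
  change ‖radial c r φ x - c‖ ≤ r ↔ _
  rw [norm_radial_sub c r hr (fun _ => h.apply_nonneg) h.apply_zero, ← div_le_one hr (a := ‖x - c‖),
    ← h.apply_le_one_iff]
  constructor
  · intro h1
    nlinarith
  · intro h1
    nlinarith

end Radial

lemma isIdNearBoundary_subtypePerm {E : Type*} [TopologicalSpace E] {s U : Set E}
    {e : Equiv.Perm E} (he : ∀ x, e x ∈ s ↔ x ∈ s) (hU : IsOpen U) (hs : frontier s ⊆ U)
    (h : ∀ x ∈ U, e x = x) : IsIdNearBoundary (e.subtypePerm he : Equiv.Perm s) := by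
  have hmem : ((↑) ⁻¹' U : Set s) ∈ 𝓝ˢ ((↑) ⁻¹' frontier s : Set s) :=
    (hU.preimage continuous_subtype_val).mem_nhdsSet.2 (preimage_mono hs)
  filter_upwards [hmem] with x hx
  exact Subtype.ext (h x hx)

lemma IsFlowChart.isLineDiffeo_flowPerm {v ξ : ℝ → ℝ} (h : IsFlowChart v ξ) (s : ℝ) :
    IsLineDiffeo (h.flowPerm s) where
  contDiff := (h.flow_smooth s).1
  deriv_pos := h.deriv_flow_pos s
  eq_self _ hx := flow_of_notMem s hx

/-- The gaps telescope inside `(1/4, 3/4)`. -/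
lemma IsFlowChart.summable_orbit {v ξ : ℝ → ℝ} (h : IsFlowChart v ξ) :
    Summable fun n : ℕ => |ξ n - ξ (n + 1)| := by
  refine summable_of_sum_range_le (c := 1) (fun n => abs_nonneg _) fun n => ?_
  have h1 : ∀ k : ℕ, |ξ k - ξ (k + 1)| = ξ ((k + 1 : ℕ) : ℝ) - ξ k := by
    intro k
    rw [abs_sub_comm, abs_of_pos (sub_pos.2 (h.strictMono (by linarith)))]
    push_cast
    rfl
  simp only [h1]
  rw [Finset.sum_range_sub (fun k : ℕ => ξ k)]
  have h2 := (h.mem_Ioo n).2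
  have h3 := (h.mem_Ioo 0).1
  rw [Nat.cast_zero]
  linarith

/-! ### The isotopy on the ball. -/

section Ball

variable {E : Type*} [NormedAddCommGroup E] [InnerProductSpace ℝ E] {c : E} {r : ℝ}

lemma radial_ray (hr : 0 < r) (f : ℝ → ℝ) {e : E} (he : ‖e‖ = 1) {ρ : ℝ} (hρ : 0 < ρ) :
    radial c r f (c + (r * ρ) • e) = c + (r * f ρ) • e := by
  rw [radial, add_sub_cancel_left, norm_smul, he, mul_one, Real.norm_of_nonneg (by positivity),
    mul_div_cancel_left₀ _ hr.ne', smul_smul, div_mul_cancel₀ _ (by positivity)]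

/-- `radial` is affine in `f`. Hence the straight-line isotopy on the ball is the radial extension
of the one on the line, which makes its stages diffeomorphisms, while its joint smoothness is
visible from the right-hand side. -/
lemma radial_linear (hr : 0 < r) (t : ℝ) (f : ℝ → ℝ) (x : E) :
    radial c r (fun ρ => (1 - t) * ρ + t * f ρ) x = (1 - t) • x + t • radial c r f x := by
  have h1 := radial_id c r hr x
  have h2 : radial c r (fun ρ => (1 - t) * ρ + t * f ρ) x =
      (1 - t) • radial c r id x + t • radial c r f x := by
    simp only [radial, id]
    module
  rw [h2, h1]

lemma isotopicToId_radial (hr : 0 < r) {φ : Equiv.Perm ℝ} (h : IsLineDiffeo φ) :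
    IsotopicToId ((radialPerm (c := c) hr h).subtypePerm (radial_mem_closedBall hr h) :
      Equiv.Perm (Metric.closedBall c r)) := by
  classical
  choose! ψ hψ hψ' using fun t (ht : t ∈ Icc (0 : ℝ) 1) => h.exists_linear_isotopy ht
  let H : ℝ → Equiv.Perm (Metric.closedBall c r) := fun t =>
    if ht : t ∈ Icc (0 : ℝ) 1 then
      (radialPerm (c := c) hr (hψ t ht)).subtypePerm (radial_mem_closedBall hr (hψ t ht))
    else 1
  have hH : ∀ t (ht : t ∈ Icc (0 : ℝ) 1), H t =
      (radialPerm (c := c) hr (hψ t ht)).subtypePerm (radial_mem_closedBall hr (hψ t ht)) :=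
    fun t ht => dif_pos ht
  have hval : ∀ t (ht : t ∈ Icc (0 : ℝ) 1) (x : E), radialPerm (c := c) hr (hψ t ht) x =
      (1 - t) • x + t • radial c r φ x := by
    intro t ht x
    rw [← radial_linear hr]
    change radial c r (ψ t) x = _
    rw [funext (hψ' t ht)]
  refine ⟨H, ?_, ?_, fun t ht => ?_, ?_⟩
  · rw [hH 0 (by simp)]
    ext x
    refine (hval 0 (by simp) x).trans ?_
    simp
  · rw [hH 1 (by simp)]
    ext x
    refine (hval 1 (by simp) x).trans ?_
    simp [radialPerm]
  · rw [hH t ht]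
    have h1 := contDiff_radial (c := c) hr (hψ t ht)
    have h2 := contDiff_radial (c := c) hr (hψ t ht).symm
    exact isDiffeo_subtypePerm _ (h1.of_le (by exact_mod_cast le_top))
      (h2.of_le (by exact_mod_cast le_top))
  · have hsm : ContDiff ℝ 1 (radial c r φ) :=
      (contDiff_radial hr h).of_le (by exact_mod_cast le_top)
    have : ContDiff ℝ 1 fun p : ℝ × E => (1 - p.1) • p.2 + p.1 • radial c r φ p.2 :=
      ((contDiff_const.sub contDiff_fst).smul contDiff_snd).add
        (contDiff_fst.smul (hsm.comp contDiff_snd))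
    refine this.contDiffOn.congr fun p hp => ?_
    rw [hH p.1 hp.1, toMap_subtypePerm _ _ hp.2, hval p.1 hp.1]

end Ball

end GrowthSequence
end

/-! ### The theorem. -/

open GrowthSequence

theorem corollary1p8 (m : ℕ) (hm : 1 ≤ m) (c : EuclideanSpace ℝ (Fin m)) (r : ℝ) (hr : 0 < r)
    (u : ℕ → ℝ) (hu_pos : ∀ n : ℕ, 1 ≤ n → 0 < u n) (hu_mono : StrictMonoOn u (Set.Ici 1))
    (hu_lim : Filter.Tendsto u Filter.atTop Filter.atTop) :
    ∃ g : Equiv.Perm (Metric.closedBall c r),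
      GrowthSequence.IsDiffeo ∞ g ∧
      g ∈ GrowthSequence.DiffZero (Metric.closedBall c r) ∧
      g ≠ 1 ∧
      GrowthSequence.IsIdNearBoundary g ∧
      GrowthSequence.HasIrregularGrowth u g ∧
      -- `g` is the radial extension of an interval diffeomorphism with the same properties
      ∃ h : Equiv.Perm (Set.Icc (0 : ℝ) 1),
        GrowthSequence.IsDiffeo ∞ h ∧
        h ≠ 1 ∧
        GrowthSequence.IsIdNearBoundary h ∧
        GrowthSequence.HasIrregularGrowth u h ∧
        ∀ x : Metric.closedBall c r, (x : EuclideanSpace ℝ (Fin m)) ≠ c →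
          (g x : EuclideanSpace ℝ (Fin m)) =
            c + (r * GrowthSequence.toMap h (‖(x : EuclideanSpace ℝ (Fin m)) - c‖ / r)
              / ‖(x : EuclideanSpace ℝ (Fin m)) - c‖) • ((x : EuclideanSpace ℝ (Fin m)) - c) := by
  -- The times at which `u` has overtaken the distortion constants; only divergence of `u` enters.
  -- `k ≤ n` makes the times cofinal, `1 ≤ n` gives `u n > 0`.
  have hex : ∀ k : ℕ, ∃ n : ℕ, k ≤ n ∧ 1 ≤ n ∧ Real.exp (k + 1) ≤ u n := fun k => by
    obtain ⟨n, h1, h2, h3⟩ := ((eventually_ge_atTop k).and ((eventually_ge_atTop 1).and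
      (hu_lim.eventually_ge_atTop (Real.exp (k + 1))))).exists
    exact ⟨n, h1, h2, h3⟩
  choose q hqk hq1 hqu using hex
  obtain ⟨v, ξ, hch, hshift⟩ := exists_flowChart q
  set φ : Equiv.Perm ℝ := hch.flowPerm 1 with hφ
  have hd : IsLineDiffeo φ := hch.isLineDiffeo_flowPerm 1
  let M : ℕ → NNReal := fun k => ⟨Real.exp (k + 1), (Real.exp_pos _).le⟩
  have hM1 : ∀ k, 1 ≤ M k := fun k => by
    rw [← NNReal.coe_le_coe]
    exact Real.one_le_exp (by positivity)
  have hpow : ∀ n : ℕ, φ ^ n = hch.flowPerm n := fun n => by rw [hφ, hch.flowPerm_pow, mul_one]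
  have hL : ∀ k, LipschitzWith (M k) (φ ^ q k : Equiv.Perm ℝ) := fun k => by
    rw [hpow]
    exact hch.lipschitzWith_flow (hM1 k) fun t => (hshift k t).1
  have hL' : ∀ k, LipschitzWith (M k) ((φ ^ q k)⁻¹ : Equiv.Perm ℝ) := fun k => by
    rw [hpow, hch.flowPerm_inv]
    exact hch.lipschitzWith_flow (hM1 k) fun t => (hshift k t).2
  have hdn : ∀ n : ℕ, IsLineDiffeo (φ ^ n) := fun n => by
    rw [hpow]
    exact hch.isLineDiffeo_flowPerm n
  have horbit : ∀ n : ℕ, (φ ^ n) (ξ 0) = ξ n := fun n => by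
    rw [hpow, hch.flowPerm_apply, hch.flow_chart, zero_add]
  have hu0 : ∀ k, 0 < u (q k) := fun k => hu_pos _ (hq1 k)
  have hIcc : ∀ x, φ x ∈ Icc (0 : ℝ) 1 ↔ x ∈ Icc (0 : ℝ) 1 := fun x => by
    rw [mem_Icc, mem_Icc, hd.apply_nonneg_iff, hd.apply_le_one_iff]
  have hξ0 := hch.mem_Ioo 0
  have hξ0' : ξ 0 ∈ Icc (0 : ℝ) 1 := ⟨by linarith [hξ0.1], by linarith [hξ0.2]⟩
  have hmove : φ (ξ 0) ≠ ξ 0 := by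
    rw [hφ, hch.flowPerm_apply, hch.flow_chart]
    exact (hch.strictMono (by norm_num)).ne'
  have hle : (1 : WithTop ℕ∞) ≤ ∞ := by exact_mod_cast le_top
  obtain ⟨e, he⟩ : ∃ e : EuclideanSpace ℝ (Fin m), ‖e‖ = 1 :=
    ⟨EuclideanSpace.single ⟨0, hm⟩ 1, by simp⟩
  have hball := radial_mem_closedBall (c := c) hr hd
  -- On the ray through `e` the radial map repeats the interval dynamics scaled by `r`, so this
  -- orbit has summable gaps too.
  set x₀ := c + (r * ξ 0) • e with hx₀
  have hx₀mem : x₀ ∈ Metric.closedBall c r := by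
    rw [mem_closedBall_iff_norm, hx₀, add_sub_cancel_left, norm_smul, he, mul_one,
      Real.norm_of_nonneg (mul_nonneg hr.le hξ0'.1)]
    nlinarith [hξ0'.2]
  have hgorbit : ∀ n : ℕ, (radialPerm (c := c) hr hd ^ n) x₀ = c + (r * ξ n) • e := fun n => by
    rw [radialPerm_pow, hx₀, radial_ray hr _ he (by linarith [hξ0.1]), horbit]
  have hgdiff : ∀ n : ℕ, ‖(radialPerm (c := c) hr hd ^ n) x₀ -
      (radialPerm (c := c) hr hd ^ (n + 1)) x₀‖ = r * |ξ n - ξ (n + 1)| := fun n => by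
    rw [hgorbit, hgorbit, add_sub_add_left_eq_sub, ← sub_smul, norm_smul, he, mul_one, ← mul_sub,
      Real.norm_eq_abs, abs_mul, abs_of_pos hr]
    push_cast
    rfl
  have hgmove : radialPerm (c := c) hr hd x₀ ≠ x₀ := by
    intro heq
    have h2 := hgdiff 0
    rw [zero_add, pow_one, pow_zero, Equiv.Perm.one_apply, heq, sub_self, norm_zero, Nat.cast_zero,
      zero_add] at h2
    have h3 : ξ 0 < ξ 1 := hch.strictMono (by norm_num)
    have := mul_pos hr (abs_pos.2 (sub_ne_zero.2 h3.ne))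
    linarith
  have hgsm : ContDiff ℝ ∞ (radialPerm (c := c) hr hd) := contDiff_radial hr hd
  have hgsm' : ContDiff ℝ ∞ (radialPerm (c := c) hr hd).symm := contDiff_radial hr hd.symm
  have hgL : ∀ k, LipschitzWith (M k) (radialPerm (c := c) hr hd ^ q k : Equiv.Perm _) := by
    intro k
    rw [funext (radialPerm_pow (c := c) hr hd (q k))]
    exact lipschitzWith_radial hr (fun _ => (hdn _).apply_nonneg) (hdn _).apply_zero (hL k)
  have hgL' : ∀ k, LipschitzWith (M k) ((radialPerm (c := c) hr hd ^ q k)⁻¹ : Equiv.Perm _) := by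
    intro k
    rw [← inv_pow, radialPerm_inv, funext (radialPerm_pow (c := c) hr hd.symm (q k))]
    have e1 : (φ.symm ^ q k : Equiv.Perm ℝ) = (φ ^ q k)⁻¹ := inv_pow φ (q k)
    rw [e1]
    exact lipschitzWith_radial hr (fun _ => (hdn _).symm.apply_nonneg) (hdn _).symm.apply_zero
      (hL' k)
  refine ⟨(radialPerm (c := c) hr hd).subtypePerm hball, isDiffeo_subtypePerm hball hgsm hgsm',
    ⟨isDiffeo_subtypePerm hball (hgsm.of_le hle) (hgsm'.of_le hle), isotopicToId_radial hr hd⟩,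
    fun heq => hgmove ?_, ?_, ?_, φ.subtypePerm hIcc,
    isDiffeo_subtypePerm hIcc hd.contDiff hd.contDiff_symm, fun heq => hmove ?_, ?_, ?_,
    fun x _ => ?_⟩
  · exact congrArg Subtype.val (Equiv.ext_iff.1 heq ⟨x₀, hx₀mem⟩)
  · refine isIdNearBoundary_subtypePerm hball (U := {x | 3 / 4 * r < ‖x - c‖})
      (isOpen_lt continuous_const (by fun_prop)) ?_ fun x hx => ?_
    · rw [frontier_closedBall c hr.ne']
      intro x hx
      rw [mem_sphere_iff_norm] at hx
      rw [mem_ofPred_eq, hx]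
      linarith
    · refine radial_of_eq_self c r hr (hd.eq_self _ fun hx' => ?_)
      have := hx'.2
      rw [div_lt_iff₀ hr] at this
      exact lt_asymm this hx
  · refine hasIrregularGrowth_subtypePerm ?_ (isCompact_closedBall c r) (convex_closedBall c r)
      hball (hgsm.of_le hle) (hgsm'.of_le hle) hgL hgL' hqk hu0 hqu hx₀mem hgmove ?_
    · refine uniqueDiffOn_convex (convex_closedBall c r) ⟨c, ?_⟩
      exact Metric.ball_subset_interior_closedBall (Metric.mem_ball_self hr)
    · simp only [hgdiff]
      exact hch.summable_orbit.mul_left r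
  · exact congrArg Subtype.val (Equiv.ext_iff.1 heq ⟨ξ 0, hξ0'⟩)
  · refine isIdNearBoundary_subtypePerm hIcc (U := (Icc (1 / 4) (3 / 4))ᶜ)
      isClosed_Icc.isOpen_compl ?_ fun x hx => hd.eq_self x fun hx' => hx (Ioo_subset_Icc_self hx')
    rw [frontier_Icc zero_le_one]
    rintro x (rfl | rfl) <;> norm_num
  · refine hasIrregularGrowth_subtypePerm (uniqueDiffOn_Icc zero_lt_one) isCompact_Icc
      (convex_Icc 0 1) hIcc (hd.contDiff.of_le hle) (hd.contDiff_symm.of_le hle) hL hL' hqk hu0 hqu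
      hξ0' hmove ?_
    simp only [horbit, Real.norm_eq_abs]
    push_cast
    exact hch.summable_orbit
  · have hx1 : ‖(x : EuclideanSpace ℝ (Fin m)) - c‖ / r ∈ Icc (0 : ℝ) 1 :=
      ⟨by positivity, (div_le_one hr).2 (mem_closedBall_iff_norm.1 x.2)⟩
    rw [toMap_subtypePerm φ hIcc hx1]
    rfl
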